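/- Rings are commutative and a subring need not contain $1$ (so $\{0\}$ is a subring). For a ring $R$ with $1$, let $\sigma(R)$ be the least number of proper subrings of $R$ whose union is $R$ if finitely many suffice; put $\sigma(R)=\infty$ if $R$ is a union of proper subrings but not of finitely many, and $\sigma(R)=\hat\infty$ if $R$ is not a union of proper subrings. These values are ordered by $1<2<\dots<\infty<\hat\infty$, and $\inf\varnothing=\hat\infty$. Let $K$ be a number field with ring of integers $A$. For a prime number $p$ and $f\ge 1$ let $N_p(f)$ be the number of monic irreducible polynomials of degree $f$ over $\mathbb F_p$, let $\lambda_p(f)$ be the number of prime ideals of $A$ lying over $p\mathbb Z$ with residual degree $f$, and let $\tau_p(1)=p$ and $\tau_p(f)=N_p(f)+1$ for $f\ge 2$. A nonzero ideal $I$ of $A$ is called faulty if there are a prime number $p$ and $f\ge1$ such that at least $\tau_p(f)$ prime ideals of $A$ lying over $p\mathbb Z$ with residual degree $f$ divide $I$. Let $\mathfrak P$ be the set of prime numbers $p$ such that (i) $p$ is a common index divisor of $K$, i.e. $p$ divides the index $[A:\mathbb Z[\theta]]$ for every $\theta\in A$ with $K=\mathbb Q(\theta)$, or (ii) $\lambda_p(1)\ge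 p$. For $p\in\mathfrak P$ let $\mathfrak F(p)$ be the set of residual degrees $f$ of prime ideals of $A$ over $p\mathbb Z$ such that $\lambda_p(f)\ge\tau_p(f)$. Theorem. The set $\mathfrak P$ is finite. Suppose that $\sigma(A)\neq\infty$ (for instance, that $A$ is finitely coverable). Then 1) $\sigma(A)=\inf_I\sigma(A/I)$, where $I$ runs through the faulty ideals of $A$; 2) $\displaystyle\sigma(A)=\inf_{p\in\mathfrak P}\ \inf_{f\in\mathfrak F(p)}\sigma\bigl(A/\mathcal P_1\times\dots\times A/\mathcal P_{\tau_p(f)}\bigr)$, where, for each $p$ and $f$, $\mathcal P_1,\dots,\mathcal P_{\tau_p(f)}$ are any distinct prime ideals of $A$ lying over $p\mathbb Z$ with residual degree $f$; 3) $\sigma(A)=\inf_{p\in\mathfrak P}\sigma(A/pA)$. If $\sigma(A)=\infty$, then $A$ has no faulty ideal and $\mathfrak P=\varnothing$, so that all these infima are taken over the empty set. -/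

import Mathlib

open NumberField Polynomial

/-- A family of non-unital subrings of `R` (a subring need not contain `1`, so `{0}` is one) which
are all proper and whose union is `R`. -/
def IsCover {R : Type*} [CommRing R] (C : Set (NonUnitalSubring R)) : Prop :=
  (∀ S ∈ C, S ≠ ⊤) ∧ ∀ x : R, ∃ S ∈ C, x ∈ S

/-- The value `∞` of the covering number: the largest element below `⊤` in `WithTop ℕ∞`. -/
def coverInfty : WithTop ℕ∞ := ((⊤ : ℕ∞) : WithTop ℕ∞)

/-- The covering number `σ(R)`, with values in `{0 < 1 < 2 < ⋯ < ∞ < ∞̂}`. It is the least number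
of members of a cover of `R` by proper subrings if there is a finite cover, `∞` (`coverInfty`) if
there are covers but no finite one, and `∞̂` (the top element `⊤`, which is the infimum of the
empty set) if there is no cover at all. -/
noncomputable def coveringNumber (R : Type*) [CommRing R] : WithTop ℕ∞ :=
  ⨅ C ∈ {C : Set (NonUnitalSubring R) | IsCover C}, ((C.encard : ℕ∞) : WithTop ℕ∞)

/-- `N_p(f)`: the number of monic irreducible polynomials of degree `f` over `𝔽_p`. -/
noncomputable def numIrred (p f : ℕ) : ℕ :=
  {g : (ZMod p)[X] | g.Monic ∧ Irreducible g ∧ g.natDegree = f}.ncard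

/-- `τ_p(f)`, which is `p` for `f = 1` and `N_p(f) + 1` for `f ≥ 2`. -/
noncomputable def tau (p f : ℕ) : ℕ :=
  if f = 1 then p else numIrred p f + 1

section NumberFields

variable (K : Type*) [Field K] [NumberField K]

/-- The prime ideals of the ring of integers lying over `pℤ` with residual degree `f`. -/
def primesOfDegree (p f : ℕ) : Set (Ideal (𝓞 K)) :=
  {P | P.IsPrime ∧ P.LiesOver (Ideal.span {(p : ℤ)}) ∧ P.inertiaDeg ℤ = f}

/-- `λ_p(f)`: the number of prime ideals lying over `pℤ` with residual degree `f`. -/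
noncomputable def numPrimes (p f : ℕ) : ℕ :=
  (primesOfDegree K p f).ncard

variable {K} in
/-- A nonzero ideal `I` is faulty if, for some prime number `p` and some `f ≥ 1`, at least
`τ_p(f)` of the prime ideals over `pℤ` of residual degree `f` divide `I`. -/
def IsFaulty (I : Ideal (𝓞 K)) : Prop :=
  I ≠ ⊥ ∧ ∃ p f : ℕ, p.Prime ∧ 0 < f ∧ tau p f ≤ {P ∈ primesOfDegree K p f | P ∣ I}.ncard

variable {K} in
/-- The index `[A : ℤ[θ]]` of additive groups, `A` being the ring of integers
(`0` if it is infinite). -/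
noncomputable def indexOf (θ : 𝓞 K) : ℕ :=
  (Subalgebra.toSubmodule (Algebra.adjoin ℤ {θ})).toAddSubgroup.index

/-- The prime number `p` divides the greatest common divisor `I(K)` of the indices `[A : ℤ[θ]]`,
where `θ` runs through the integers of `K` with `K = ℚ(θ)`; that is, it divides all of them. -/
def IsCommonIndexDivisor (p : ℕ) : Prop :=
  p.Prime ∧ ∀ θ : 𝓞 K, IntermediateField.adjoin ℚ {(θ : K)} = ⊤ → p ∣ indexOf θ

/-- The set `𝔓` of the prime numbers `p` that are common index divisors or have at least `p`
prime ideals of residual degree `1` over them. -/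
def badPrimes : Set ℕ :=
  {p | p.Prime ∧ (IsCommonIndexDivisor K p ∨ p ≤ numPrimes K p 1)}

/-- `𝔉(p)`: the residual degrees `f` of prime ideals over `pℤ` with `λ_p(f) ≥ τ_p(f)`, i.e.
`λ_p(f) > N_p(f)` if `f ≥ 2`, and `λ_p(1) ≥ p` if `f = 1`. -/
def badDegrees (p : ℕ) : Set ℕ :=
  {f | (primesOfDegree K p f).Nonempty ∧ tau p f ≤ numPrimes K p f}

end NumberFields

/-! ### Covers, quotients and a Nakayama argument for subrings. -/

section Covers

variable {R S : Type*} [CommRing R] [CommRing S]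

/-! Covers pull back along surjections, so `σ(A)` is at most each infimum. Conversely, a finite
cover of `A` is pushed down to smaller and smaller quotients. By Neumann's lemma only members of
finite index matter; each is proper modulo some prime number, and by CRT the images cover some
`A/pA`. A suitable lift `y` of each residue class has `y ^ p ^ N - y` as a simultaneous uniformizer
at the primes over `p`, so by Nakayama the radical of `pA` may replace `pA`. Powers of Frobenius
separate residue fields of different degrees, so a second CRT argument leaves a single degree `f`,
that is, the ring `F ^ λ` with `F` the field of `p ^ f` elements. A vector generates `F ^ λ` when
its coordinates have distinct minimal polynomials of degree `f`, none equal to `X`; just `τ - 1`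
such polynomials exist, so `F ^ λ` has a cover exactly when `λ ≥ τ`. Above that bound `σ(F ^ n)` is
nondecreasing in `n` (`coveringNumber_pi_fin_le_succ`), and `λ` drops to `τ`. The link with indices
is Hensel's: if `p` does not divide the index of `θ`, a map from `A` to a field of characteristic
`p` is determined by the image of `θ`; and a generator of `A/pA` lifts to such a `θ`. -/

theorem IsCover.coveringNumber_le {C : Set (NonUnitalSubring R)} (hC : IsCover C) :
    coveringNumber R ≤ ((C.encard : ℕ∞) : WithTop ℕ∞) :=
  iInf₂_le (f := fun (C : Set (NonUnitalSubring R))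
    (_ : IsCover C) => ((C.encard : ℕ∞) : WithTop ℕ∞)) C hC

theorem exists_isCover_encard_eq (h : coveringNumber R ≠ ⊤) :
    ∃ C : Set (NonUnitalSubring R), IsCover C ∧
      ((C.encard : ℕ∞) : WithTop ℕ∞) = coveringNumber R := by
  have hne : Nonempty {C : Set (NonUnitalSubring R) // IsCover C} := by
    by_contra hcon
    refine h ?_
    simp only [coveringNumber, iInf_eq_top]
    exact fun _ hC => (hcon ⟨_, hC⟩).elim
  obtain ⟨C, hC⟩ := ciInf_mem
    (fun C : {C : Set (NonUnitalSubring R) // IsCover C} => ((C.1.encard : ℕ∞) : WithTop ℕ∞))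
  refine ⟨C.1, C.2, hC.trans ?_⟩
  rw [coveringNumber, iInf_subtype']
  rfl

theorem le_coveringNumber {a : WithTop ℕ∞}
    (h : ∀ C : Set (NonUnitalSubring R), IsCover C → a ≤ ((C.encard : ℕ∞) : WithTop ℕ∞)) :
    a ≤ coveringNumber R :=
  le_iInf₂ h

theorem IsCover.comap {C : Set (NonUnitalSubring S)} (hC : IsCover C) {φ : R →+* S}
    (hφ : Function.Surjective φ) : IsCover ((fun M => M.comap φ) '' C) := by
  refine ⟨?_, fun x => ?_⟩
  · rintro _ ⟨M, hM, rfl⟩ h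
    refine hC.1 M hM (eq_top_iff.2 fun y _ => ?_)
    obtain ⟨x, rfl⟩ := hφ y
    exact h.ge (NonUnitalSubring.mem_top x)
  · obtain ⟨M, hM, hx⟩ := hC.2 (φ x)
    exact ⟨_, ⟨M, hM, rfl⟩, hx⟩

theorem coveringNumber_le_of_surjective {φ : R →+* S} (hφ : Function.Surjective φ) :
    coveringNumber R ≤ coveringNumber S :=
  le_coveringNumber fun _ hC => (hC.comap hφ).coveringNumber_le.trans
    (WithTop.coe_le_coe.2 (Set.encard_image_le _ _))

theorem coveringNumber_congr (e : R ≃+* S) : coveringNumber R = coveringNumber S :=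
  le_antisymm (coveringNumber_le_of_surjective (φ := e.toRingHom) e.surjective)
    (coveringNumber_le_of_surjective (φ := e.symm.toRingHom) e.symm.surjective)

theorem IsCover.lt_coverInfty {C : Set (NonUnitalSubring R)} (hC : IsCover C) (hfin : C.Finite) :
    coveringNumber R < coverInfty :=
  hC.coveringNumber_le.trans_lt (WithTop.coe_lt_coe.2 (Set.encard_lt_top_iff.2 hfin))

/-- The subrings generated by single elements form a cover unless one of them is `R`, while a
generator of `R` lies in no proper subring. -/
theorem coveringNumber_eq_top_iff :
    coveringNumber R = ⊤ ↔ ∃ x : R, NonUnitalSubring.closure {x} = ⊤ := by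
  constructor
  · intro h
    by_contra! hcon
    have hC : IsCover (Set.range fun x : R => NonUnitalSubring.closure {x}) := by
      refine ⟨?_, fun x => ⟨_, ⟨x, rfl⟩, NonUnitalSubring.subset_closure (Set.mem_singleton _)⟩⟩
      rintro _ ⟨x, rfl⟩
      exact hcon x
    have := hC.coveringNumber_le
    rw [h, top_le_iff] at this
    exact WithTop.coe_ne_top this
  · rintro ⟨x, hx⟩
    by_contra h
    obtain ⟨C, hC, -⟩ := exists_isCover_encard_eq h
    obtain ⟨M, hM, hxM⟩ := hC.2 x
    refine hC.1 M hM (top_le_iff.1 ?_)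
    rw [← hx, NonUnitalSubring.closure_le]
    simpa using hxM

theorem coveringNumber_lt_coverInfty [Finite R] (h : coveringNumber R ≠ ⊤) :
    coveringNumber R < coverInfty := by
  obtain ⟨C, hC, -⟩ := exists_isCover_encard_eq h
  have : Finite (NonUnitalSubring R) := Finite.of_injective _ SetLike.coe_injective
  exact hC.lt_coverInfty C.toFinite

theorem lt_coverInfty_iff {a : WithTop ℕ∞} : a < coverInfty ↔ a ≠ ⊤ ∧ a ≠ coverInfty := by
  cases a with
  | top => simp
  | coe a =>
    simp only [coverInfty, WithTop.coe_lt_coe, ne_eq, WithTop.coe_ne_top, not_false_eq_true,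
      true_and, WithTop.coe_inj]
    exact lt_top_iff_ne_top

theorem map_mk_eq_top_iff {M : NonUnitalSubring R} {I : Ideal R} :
    M.map (Ideal.Quotient.mk I) = ⊤ ↔ ∀ x, ∃ m ∈ M, m - x ∈ I := by
  constructor
  · intro h x
    have : Ideal.Quotient.mk I x ∈ M.map (Ideal.Quotient.mk I) := h ▸ NonUnitalSubring.mem_top _
    obtain ⟨m, hm, h⟩ := NonUnitalSubring.mem_map.1 this
    exact ⟨m, hm, Ideal.Quotient.eq.1 h⟩
  · intro h
    refine eq_top_iff.2 fun y _ => ?_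
    obtain ⟨x, rfl⟩ := Ideal.Quotient.mk_surjective y
    obtain ⟨m, hm, h⟩ := h x
    exact NonUnitalSubring.mem_map.2 ⟨m, hm, Ideal.Quotient.eq.2 h⟩

/-- If each member of a cover has a proper image in one of finitely many quotients by pairwise
coprime ideals, then the images cover one of these quotients. -/
theorem IsCover.exists_coveringNumber_quotient_le {C : Set (NonUnitalSubring R)} (hC : IsCover C)
    {ι : Type*} [Finite ι] {I : ι → Ideal R} (hI : Pairwise (Function.onFun IsCoprime I))
    (h : ∀ M ∈ C, ∃ k, M.map (Ideal.Quotient.mk (I k)) ≠ ⊤) :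
    ∃ k, coveringNumber (R ⧸ I k) ≤ ((C.encard : ℕ∞) : WithTop ℕ∞) := by
  let D (k : ι) : Set (NonUnitalSubring (R ⧸ I k)) :=
    {N ∈ (fun M => M.map (Ideal.Quotient.mk (I k))) '' C | N ≠ ⊤}
  have hD (k) : (D k).encard ≤ C.encard :=
    (Set.encard_le_encard (Set.sep_subset _ _)).trans (Set.encard_image_le _ _)
  suffices ∃ k, IsCover (D k) by
    obtain ⟨k, hk⟩ := this
    exact ⟨k, hk.coveringNumber_le.trans (WithTop.coe_le_coe.2 (hD k))⟩
  by_contra! hcon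
  have hx (k) : ∃ x : R ⧸ I k, ∀ N ∈ D k, x ∉ N := by
    by_contra! hcov
    exact hcon k ⟨fun N hN => hN.2, hcov⟩
  choose x hx using hx
  -- CRT glues the points missed in the quotients to one `y`. The member containing `y` has a proper
  -- image in some quotient, and that image contains a missed point.
  obtain ⟨y, hy⟩ := Ideal.quotientInfToPiQuotient_surj hI x
  obtain ⟨y, rfl⟩ := Ideal.Quotient.mk_surjective y
  obtain ⟨M, hM, hyM⟩ := hC.2 y
  obtain ⟨k, hk⟩ := h M hM
  refine hx k _ ⟨⟨M, hM, rfl⟩, hk⟩ ?_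
  rw [← hy, Ideal.quotientInfToPiQuotient_mk']
  exact NonUnitalSubring.mem_map.2 ⟨y, hyM, rfl⟩

/-- Substituting `R = M + zR` into itself, with `zM ⊆ M`, gives `R = M + z ^ n R`. -/
theorem mem_of_smul_generates {M : NonUnitalSubring R} {z : R} (hz : ∀ m ∈ M, z * m ∈ M)
    (hgen : ∀ x, ∃ m ∈ M, m - x ∈ Ideal.span {z}) (n : ℕ) (x : R) :
    ∃ m ∈ M, m - x ∈ Ideal.span {z ^ n} := by
  induction n generalizing x with
  | zero => exact ⟨0, M.zero_mem, by simp⟩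
  | succ n ih =>
    obtain ⟨m, hm, hmx⟩ := hgen x
    obtain ⟨a, ha⟩ := Ideal.mem_span_singleton'.1 hmx
    obtain ⟨b, hb, hba⟩ := ih a
    obtain ⟨c, hc⟩ := Ideal.mem_span_singleton'.1 hba
    refine ⟨m - z * b, M.sub_mem hm (hz b hb), Ideal.mem_span_singleton'.2 ⟨-c, ?_⟩⟩
    linear_combination ha - z * hc

/-- A form of Nakayama's lemma for subrings. -/
theorem eq_top_of_map_mk_eq_top {M : NonUnitalSubring R} {z : R} {n : ℕ}
    (hz : ∀ m ∈ M, z * m ∈ M) (hn : ∀ x, z ^ n * x ∈ M)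
    (hM : M.map (Ideal.Quotient.mk (Ideal.span {z})) = ⊤) : M = ⊤ := by
  refine eq_top_iff.2 fun x _ => ?_
  obtain ⟨m, hm, hmx⟩ := mem_of_smul_generates hz (map_mk_eq_top_iff.1 hM) n x
  obtain ⟨a, ha⟩ := Ideal.mem_span_singleton'.1 hmx
  have : x = m - z ^ n * a := by linear_combination ha
  rw [this]
  exact M.sub_mem hm (hn a)

end Covers

/-! ### Minimal polynomials and generators of powers of a finite field. -/

section FiniteFields

variable {p f : ℕ} [Fact p.Prime] {F : Type*} [Field F] [Finite F] [Algebra (ZMod p) F]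

/-- The monic irreducible polynomials of degree `f` over `𝔽_p` other than `X`. -/
def irredNeX (p f : ℕ) : Set (ZMod p)[X] :=
  {g | (g.Monic ∧ Irreducible g ∧ g.natDegree = f) ∧ g ≠ X}

theorem finite_natDegree_eq (p f : ℕ) [Fact p.Prime] :
    {g : (ZMod p)[X] | g.natDegree = f}.Finite := by
  refine Set.Finite.of_injOn (f := fun g (i : Fin (f + 1)) => g.coeff i) (t := Set.univ)
    (fun _ _ => Set.mem_univ _) (fun g hg h hh hgh => ?_) Set.finite_univ
  ext n
  by_cases hn : n < f + 1
  · exact congr_fun hgh ⟨n, hn⟩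
  · simp only [Set.mem_ofPred_eq] at hg hh
    rw [coeff_eq_zero_of_natDegree_lt (by omega), coeff_eq_zero_of_natDegree_lt (by omega)]

theorem finite_irredNeX : (irredNeX p f).Finite :=
  (finite_natDegree_eq p f).subset fun _ hg => hg.1.2.2

theorem numIrred_one : numIrred p 1 = p := by
  have : {g : (ZMod p)[X] | g.Monic ∧ Irreducible g ∧ g.natDegree = 1} =
      Set.range fun a : ZMod p => X + C a := by
    ext g
    constructor
    · rintro ⟨hm, -, hd⟩
      exact ⟨g.coeff 0, (hm.eq_X_add_C hd).symm⟩
    · rintro ⟨a, rfl⟩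
      refine ⟨monic_X_add_C a, ?_, natDegree_X_add_C a⟩
      exact irreducible_of_degree_eq_one (degree_X_add_C a)
  rw [numIrred, this, Set.ncard_eq_toFinset_card', Set.toFinset_range, Finset.card_image_of_injective]
  · simp [ZMod.card]
  · intro a b hab
    simpa using hab

/-- Excluding `X` matters only in degree 1, where `N_p(1) = p`; this unifies the two cases of `τ`.
The exclusion is there because `0` generates nothing without a one. -/
theorem ncard_irredNeX : (irredNeX p f).ncard + 1 = tau p f := by
  have hfin : {g : (ZMod p)[X] | g.Monic ∧ Irreducible g ∧ g.natDegree = f}.Finite :=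
    (finite_natDegree_eq p f).subset fun _ hg => hg.2.2
  have hdiff : irredNeX p f =
      {g : (ZMod p)[X] | g.Monic ∧ Irreducible g ∧ g.natDegree = f} \ {X} := rfl
  unfold tau
  split_ifs with hf
  · subst hf
    rw [hdiff, Set.ncard_sdiff_singleton_add_one (Set.mem_ofPred_eq ▸
      ⟨monic_X, irreducible_X, natDegree_X⟩) hfin]
    exact numIrred_one
  · rw [hdiff, Set.sdiff_singleton_eq_self]
    · rfl
    · rintro ⟨-, -, h⟩
      exact hf (natDegree_X.symm.trans h).symm

theorem adjoin_eq_top_of_forall_algEquiv {a : F}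
    (ha : ∀ φ : F ≃ₐ[ZMod p] F, φ a = a → φ = 1) :
    IntermediateField.adjoin (ZMod p) {a} = ⊤ := by
  have h : (IntermediateField.adjoin (ZMod p) {a}).fixingSubgroup = ⊥ := by
    refine eq_bot_iff.2 fun φ hφ => ?_
    refine Subgroup.mem_bot.2 (ha φ ?_)
    exact (IntermediateField.mem_fixingSubgroup_iff _ _).1 hφ a
      (IntermediateField.mem_adjoin_simple_self _ a)
  rw [← IsGalois.fixedField_fixingSubgroup (IntermediateField.adjoin (ZMod p) {a}), h,
    IntermediateField.fixedField_bot]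

/-- Among at least `τ_p(f)` elements of the field with `p ^ f` elements, one does not generate the
field as a ring without one, or two are conjugate. -/
theorem exists_fixed_or_conjugate (hf : Module.finrank (ZMod p) F = f) {ι : Type*} [Finite ι]
    (hι : tau p f ≤ Nat.card ι) (y : ι → F) :
    (∃ j, ∃ φ : F ≃ₐ[ZMod p] F, φ (y j) = y j ∧ (φ = 1 → y j = 0)) ∨
      ∃ i j, i ≠ j ∧ ∃ φ : F ≃ₐ[ZMod p] F, y i = φ (y j) := by
  by_contra! hcon
  obtain ⟨h₁, h₂⟩ := hcon
  have hint (j) : IsIntegral (ZMod p) (y j) := .of_finite _ _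
  have hmem (j) : minpoly (ZMod p) (y j) ∈ irredNeX p f := by
    refine ⟨⟨minpoly.monic (hint j), minpoly.irreducible (hint j), ?_⟩, fun hX => ?_⟩
    · have := adjoin_eq_top_of_forall_algEquiv (a := y j) fun φ hφ => (h₁ j φ hφ).1
      rw [← hf, ← IntermediateField.adjoin.finrank (hint j), this,
        IntermediateField.finrank_top']
    · have : y j = 0 := by simpa [hX] using minpoly.aeval (ZMod p) (y j)
      exact (h₁ j 1 rfl).2 this
  have hinj : Function.Injective fun j => (⟨_, hmem j⟩ : irredNeX p f) := by
    intro i j hij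
    by_contra hne
    obtain ⟨φ, hφ⟩ := (Normal.minpoly_eq_iff_mem_orbit F).1 (Subtype.ext_iff.1 hij)
    exact h₂ i j hne φ hφ.symm
  have : Finite (irredNeX p f) := finite_irredNeX
  have := Nat.card_le_card_of_injective _ hinj
  rw [Nat.card_coe_set_eq] at this
  have := ncard_irredNeX (p := p) (f := f)
  omega

/-- Polynomials without constant term can be evaluated inside a subring lacking 1, as scalars from
`ZMod p` act like integers. -/
theorem mul_aeval_mem_closure {R : Type*} [CommRing R] [Algebra (ZMod p) R] (a : R)
    (H : (ZMod p)[X]) : a * aeval a H ∈ NonUnitalSubring.closure {a} := by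
  induction H using Polynomial.induction_on with
  | C c =>
    obtain ⟨n, rfl⟩ := ZMod.natCast_zmod_surjective c
    have : a * aeval a (C (n : ZMod p)) = n • a := by simp [mul_comm]
    rw [this]
    exact nsmul_mem (NonUnitalSubring.subset_closure (Set.mem_singleton _)) n
  | add P Q hP hQ => rw [map_add, mul_add]; exact add_mem hP hQ
  | monomial n c hc =>
    have : a * aeval a (C c * X ^ (n + 1)) = a * (a * aeval a (C c * X ^ n)) := by
      simp only [map_mul, map_pow, aeval_X, pow_succ]; ring
    rw [this]
    exact mul_mem (NonUnitalSubring.subset_closure (Set.mem_singleton _)) hc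

/-- There are enough polynomials in `irredNeX` to give each coordinate its own; a vector `a` of
roots is then a generator, by CRT in `𝔽_p[X]`. -/
theorem coveringNumber_pi_eq_top (hf : Module.finrank (ZMod p) F = f) {ι : Type*} [Finite ι]
    (hι : Nat.card ι < tau p f) : coveringNumber (ι → F) = ⊤ := by
  have := ncard_irredNeX (p := p) (f := f)
  have : Finite (irredNeX p f) := finite_irredNeX
  have hle : Nat.card ι ≤ Nat.card (irredNeX p f) := by
    rw [Nat.card_coe_set_eq]
    omega
  cases nonempty_fintype ι
  cases nonempty_fintype (irredNeX p f)
  rw [Nat.card_eq_fintype_card, Nat.card_eq_fintype_card] at hle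
  obtain ⟨g⟩ := Function.Embedding.nonempty_of_card_le hle
  have hroot (i) : ∃ a : F, aeval a (g i).1 = 0 := by
    obtain ⟨⟨-, hirr, hdeg⟩, -⟩ := (g i).2
    have : Fact (Irreducible (g i).1) := ⟨hirr⟩
    have : Finite (AdjoinRoot (g i).1) := by
      have := Module.Finite.of_basis (AdjoinRoot.powerBasis hirr.ne_zero).basis
      exact Module.finite_of_finite (ZMod p)
    obtain ⟨φ⟩ := FiniteField.nonempty_algHom_of_finrank_dvd (F := ZMod p)
      (K := AdjoinRoot (g i).1) (L := F) (by
        rw [(AdjoinRoot.powerBasis hirr.ne_zero).finrank, AdjoinRoot.powerBasis_dim, hdeg, hf])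
    refine ⟨φ (AdjoinRoot.root _), ?_⟩
    rw [aeval_algHom_apply, AdjoinRoot.aeval_eq, AdjoinRoot.mk_self, map_zero]
  choose a ha using hroot
  have hint (j) : IsIntegral (ZMod p) (a j) := .of_finite _ _
  have hmin (i) : minpoly (ZMod p) (a i) = (g i).1 :=
    (minpoly.eq_of_irreducible_of_monic (g i).2.1.2.1 (ha i) (g i).2.1.1).symm
  have hgen (i) : IntermediateField.adjoin (ZMod p) {a i} = ⊤ := by
    refine IntermediateField.eq_of_le_of_finrank_eq le_top ?_
    rw [IntermediateField.adjoin.finrank (hint i), hmin, (g i).2.1.2.2,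
      IntermediateField.finrank_top', hf]
  have hne (i) : a i ≠ 0 := by
    intro h0
    apply (g i).2.2
    rw [← hmin, h0, minpoly.zero]
  refine coveringNumber_eq_top_iff.2 ⟨a, eq_top_iff.2 fun v _ => ?_⟩
  have hv (i) : ∃ h : (ZMod p)[X], aeval (a i) h = v i := by
    have : v i ∈ (IntermediateField.adjoin (ZMod p) {a i}).toSubalgebra := by
      rw [hgen]; trivial
    rw [IntermediateField.adjoin_simple_toSubalgebra_of_isAlgebraic
        (hint i).isAlgebraic,
      Algebra.adjoin_singleton_eq_range_aeval] at this
    exact this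
  choose h hh using hv
  have hcop : Pairwise (Function.onFun IsCoprime
      fun i => Ideal.span {(g i).1}) := by
    intro i j hij
    rw [Function.onFun, Ideal.isCoprime_span_singleton_iff]
    refine ((g i).2.1.2.1.coprime_iff_not_dvd).2 fun hdvd => hij (g.injective (Subtype.ext ?_))
    exact eq_of_monic_of_associated (g i).2.1.1 (g j).2.1.1
      ((g i).2.1.2.1.associated_of_dvd (g j).2.1.2.1 hdvd)
  obtain ⟨H, hH⟩ := Ideal.exists_forall_sub_mem_ideal hcop h
  have hHa : aeval a H = v := by
    ext i
    obtain ⟨c, hc⟩ := Ideal.mem_span_singleton'.1 (hH i)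
    have : aeval (a i) H = aeval (a i) (h i) := by
      rw [← sub_eq_zero, ← map_sub, ← hc, map_mul, ha, mul_zero]
    rw [← hh i, ← this]
    exact (aeval_algHom_apply (Pi.evalAlgHom (ZMod p) (fun _ : ι => F) i) a H).symm
  -- All coordinates are nonzero, so `a` is a unit with a power of `a` as inverse; this factor
  -- removes the constant term from the interpolating polynomial `H`.
  have hone : a * a ^ (Nat.card F - 2) = 1 := by
    ext i
    cases nonempty_fintype F
    have h2 : 1 < Nat.card F := Finite.one_lt_card
    simp only [Pi.mul_apply, Pi.pow_apply, Pi.one_apply, ← pow_succ']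
    rw [show Nat.card F - 2 + 1 = Fintype.card F - 1 by rw [← Nat.card_eq_fintype_card]; omega]
    exact FiniteField.pow_card_sub_one_eq_one _ (hne i)
  have : v = a * aeval a (X ^ (Nat.card F - 2) * H) := by
    rw [map_mul, map_pow, aeval_X, ← mul_assoc, hone, one_mul, hHa]
  rw [this]
  exact mul_aeval_mem_closure _ _

end FiniteFields

/-! ### Covers of powers of a finite field and monotonicity of their covering numbers. -/

section PiCovers

variable {p f : ℕ} [Fact p.Prime] {F : Type*} [Field F] [Algebra (ZMod p) F]
  {ι : Type*}

/-- The vectors whose coordinates `i` and `j` are conjugate under `φ`. -/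
def conjugateSubring (i j : ι) (φ : F ≃ₐ[ZMod p] F) : NonUnitalSubring (ι → F) where
  carrier := {x | x i = φ (x j)}
  zero_mem' := by simp
  add_mem' {x y} (hx : x i = φ (x j)) (hy : y i = φ (y j)) :=
    show (x + y) i = φ ((x + y) j) by simp [hx, hy]
  neg_mem' {x} (hx : x i = φ (x j)) := show (-x) i = φ ((-x) j) by simp [hx]
  mul_mem' {x y} (hx : x i = φ (x j)) (hy : y i = φ (y j)) :=
    show (x * y) i = φ ((x * y) j) by simp [hx, hy]

/-- The vectors whose coordinate `j` is fixed by `φ`, if `φ ≠ 1`, and `0`, if `φ = 1`. -/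
def fixedSubring (j : ι) (φ : F ≃ₐ[ZMod p] F) : NonUnitalSubring (ι → F) where
  carrier := {x | φ (x j) = x j ∧ (φ = 1 → x j = 0)}
  zero_mem' := by simp
  add_mem' {x y} (hx : φ (x j) = x j ∧ (φ = 1 → x j = 0))
      (hy : φ (y j) = y j ∧ (φ = 1 → y j = 0)) :=
    show φ ((x + y) j) = (x + y) j ∧ (φ = 1 → (x + y) j = 0) from
      ⟨by simp [hx.1, hy.1], fun h => by simp [hx.2 h, hy.2 h]⟩
  neg_mem' {x} (hx : φ (x j) = x j ∧ (φ = 1 → x j = 0)) :=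
    show φ ((-x) j) = (-x) j ∧ (φ = 1 → (-x) j = 0) from
      ⟨by simp [hx.1], fun h => by simp [hx.2 h]⟩
  mul_mem' {x y} (hx : φ (x j) = x j ∧ (φ = 1 → x j = 0))
      (hy : φ (y j) = y j ∧ (φ = 1 → y j = 0)) :=
    show φ ((x * y) j) = (x * y) j ∧ (φ = 1 → (x * y) j = 0) from
      ⟨by simp [hx.1, hy.1], fun h => by simp [hx.2 h, hy.2 h]⟩

theorem mem_conjugateSubring {i j : ι} {φ : F ≃ₐ[ZMod p] F} {x : ι → F} :
    x ∈ conjugateSubring i j φ ↔ x i = φ (x j) := Iff.rfl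

theorem conjugateSubring_ne_top {i j : ι} (hij : i ≠ j) (φ : F ≃ₐ[ZMod p] F) :
    conjugateSubring i j φ ≠ ⊤ := by
  classical
  intro h
  have : Pi.single i (1 : F) ∈ conjugateSubring i j φ := h ▸ NonUnitalSubring.mem_top _
  simp [mem_conjugateSubring, hij.symm] at this

theorem fixedSubring_ne_top (j : ι) (φ : F ≃ₐ[ZMod p] F) : fixedSubring j φ ≠ ⊤ := by
  intro h
  have hmem (a : F) : (fun _ : ι => a) ∈ fixedSubring j φ := h ▸ NonUnitalSubring.mem_top _
  have h1 : φ = 1 := AlgEquiv.ext fun a => (hmem a).1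
  exact one_ne_zero ((hmem 1).2 h1)

/-- The subring is a complement of the `i`-th axis and projects onto the `i`-th factor, so a single
further element yields the whole axis. -/
theorem eq_top_of_conjugateSubring_lt {i j : ι} (hij : i ≠ j) {φ : F ≃ₐ[ZMod p] F}
    {M : NonUnitalSubring (ι → F)} (h : conjugateSubring i j φ < M) : M = ⊤ := by
  classical
  obtain ⟨hle, y, hyM, hy⟩ := SetLike.lt_iff_le_and_exists.1 h
  have hsub (x : ι → F) :
      x - Pi.single i (x i - φ (x j)) ∈ conjugateSubring i j φ := by
    simp [mem_conjugateSubring, hij.symm]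
  have hc : y i - φ (y j) ≠ 0 := sub_ne_zero.2 hy
  set c := y i - φ (y j) with hcdef
  have hcM : Pi.single i c ∈ M := by
    have := M.sub_mem hyM (hle (hsub y))
    simpa [← hcdef] using this
  have hall (a : F) : Pi.single i a ∈ M := by
    let w : ι → F := fun l => if l = i then a / c else φ.symm (a / c)
    have hw : w ∈ M := hle (by simp [mem_conjugateSubring, w, hij.symm])
    have : Pi.single i a = Pi.single i c * w := by
      ext l
      by_cases hl : l = i
      · subst hl
        simp [w, mul_div_cancel₀ _ hc]
      · simp [hl]
    rw [this]
    exact M.mul_mem hcM hw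
  refine eq_top_iff.2 fun x _ => ?_
  have := M.add_mem (hle (hsub x)) (hall (x i - φ (x j)))
  simpa using this

/-- The unit vectors outside the subring recover `{i, j}`, and its members recover `φ`. Ordering the
pair is needed, since `(j, i, φ⁻¹)` gives the same subring. -/
theorem conjugateSubring_injective [LinearOrder ι] :
    Function.Injective fun t : {t : ι × ι // t.1 < t.2} × (F ≃ₐ[ZMod p] F) =>
      conjugateSubring t.1.1.1 t.1.1.2 t.2 := by
  rintro ⟨⟨⟨i, j⟩, hij⟩, φ⟩ ⟨⟨⟨i', j'⟩, hij'⟩, φ'⟩ h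
  simp only at h hij hij'
  have key (x : ι → F) : x i = φ (x j) ↔ x i' = φ' (x j') := by
    rw [← mem_conjugateSubring, h, mem_conjugateSubring]
  have hi : i = i' ∨ i = j' := by
    by_contra! hne
    have := (key (Pi.single i 1)).2 (by simp [hne.1.symm, hne.2.symm])
    simp [hij.ne'] at this
  have hj : j = i' ∨ j = j' := by
    by_contra! hne
    have := (key (Pi.single j 1)).2 (by simp [hne.1.symm, hne.2.symm])
    simp [hij.ne] at this
  have hii : i = i' ∧ j = j' := by
    rcases hi with rfl | rfl <;> rcases hj with rfl | rfl
    · exact (lt_irrefl _ hij).elim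
    · exact ⟨rfl, rfl⟩
    · exact (lt_asymm hij hij').elim
    · exact (lt_irrefl _ hij).elim
  obtain ⟨rfl, rfl⟩ := hii
  have : φ = φ' := by
    ext a
    have := (key fun l => if l = j then a else φ a).1 (by simp [hij.ne])
    simpa [hij.ne] using this
  rw [this]

variable [Finite F]

theorem isCover_fixedSubring_conjugateSubring (hf : Module.finrank (ZMod p) F = f) [Finite ι]
    [LinearOrder ι] (hι : tau p f ≤ Nat.card ι) :
    IsCover ((Set.range fun t : ι × (F ≃ₐ[ZMod p] F) => fixedSubring t.1 t.2) ∪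
      Set.range fun t : {t : ι × ι // t.1 < t.2} × (F ≃ₐ[ZMod p] F) =>
        conjugateSubring t.1.1.1 t.1.1.2 t.2) := by
  refine ⟨?_, fun y => ?_⟩
  · rintro _ (⟨t, rfl⟩ | ⟨t, rfl⟩)
    · exact fixedSubring_ne_top _ _
    · exact conjugateSubring_ne_top t.1.2.ne _
  · rcases exists_fixed_or_conjugate hf hι y with ⟨j, φ, h⟩ | ⟨i, j, hij, φ, h⟩
    · exact ⟨_, .inl ⟨(j, φ), rfl⟩, h⟩
    · rcases hij.lt_or_gt with hlt | hlt
      · exact ⟨_, .inr ⟨(⟨(i, j), hlt⟩, φ), rfl⟩, h⟩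
      · refine ⟨_, .inr ⟨(⟨(j, i), hlt⟩, φ.symm), rfl⟩, ?_⟩
        rw [mem_conjugateSubring, h, AlgEquiv.symm_apply_apply]

/-- If a cover of `F ^ (n + 1)` omits some conjugate subring, then by maximality no member contains
that subring, a copy of `F ^ n`, and the cover restricts to it. If it omits none, it is at least as
large as the standard cover of `F ^ n`, whose parameters are matched with those of the conjugate
subrings. -/
theorem coveringNumber_pi_fin_le_succ (hf : Module.finrank (ZMod p) F = f) {n : ℕ}
    (hn : tau p f ≤ n) :
    coveringNumber (Fin n → F) ≤ coveringNumber (Fin (n + 1) → F) := by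
  refine le_coveringNumber fun C hC => ?_
  by_cases hall : ∀ t : {t : Fin (n + 1) × Fin (n + 1) // t.1 < t.2} × (F ≃ₐ[ZMod p] F),
      conjugateSubring t.1.1.1 t.1.1.2 t.2 ∈ C
  -- Pairs `(0, j + 1)` index the fixed subrings and pairs `(i + 1, j + 1)` the conjugate ones.
  · let h (t : {t : Fin (n + 1) × Fin (n + 1) // t.1 < t.2} × (F ≃ₐ[ZMod p] F)) :
        NonUnitalSubring (Fin n → F) :=
      Fin.cases (fixedSubring (t.1.1.2.pred (Fin.ne_zero_of_lt t.1.2)) t.2)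
        (fun i => conjugateSubring i (t.1.1.2.pred (Fin.ne_zero_of_lt t.1.2)) t.2) t.1.1.1
    have hcov : IsCover (Set.range h) := by
      have hcov := isCover_fixedSubring_conjugateSubring (F := F) hf (ι := Fin n) (by simpa using hn)
      suffices (Set.range h) = (Set.range fun t :
          Fin n × (F ≃ₐ[ZMod p] F) => fixedSubring t.1 t.2) ∪
          Set.range fun t : {t : Fin n × Fin n // t.1 < t.2} × (F ≃ₐ[ZMod p] F) =>
          conjugateSubring t.1.1.1 t.1.1.2 t.2 by rwa [this]
      refine Set.Subset.antisymm ?_ ?_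
      · rintro _ ⟨⟨⟨⟨i, j⟩, hij⟩, φ⟩, rfl⟩
        obtain ⟨j, rfl⟩ := Fin.exists_succ_eq.2 (Fin.ne_zero_of_lt hij)
        cases i using Fin.cases with
        | zero => exact .inl ⟨(j, φ), rfl⟩
        | succ i => exact .inr ⟨(⟨(i, j), Fin.succ_lt_succ_iff.1 hij⟩, φ), rfl⟩
      · rintro _ (⟨⟨j, φ⟩, rfl⟩ | ⟨⟨⟨⟨i, j⟩, hij⟩, φ⟩, rfl⟩)
        · exact ⟨(⟨(0, j.succ), Fin.succ_pos j⟩, φ), rfl⟩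
        · exact ⟨(⟨(i.succ, j.succ), Fin.succ_lt_succ_iff.2 hij⟩, φ), rfl⟩
    refine hcov.coveringNumber_le.trans (WithTop.coe_le_coe.2 ?_)
    calc (Set.range h).encard ≤ (Set.univ).encard := by
          rw [← Set.image_univ]
          exact Set.encard_image_le _ _
      _ = (Set.range _).encard := by
          rw [← Set.image_univ, (conjugateSubring_injective (F := F)).encard_image]
      _ ≤ C.encard := Set.encard_le_encard (Set.range_subset_iff.2 hall)
  · push Not at hall
    obtain ⟨⟨⟨⟨i, j⟩, hij⟩, φ⟩, hD⟩ := hall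
    simp only at hij hD
    obtain ⟨k, rfl⟩ := Fin.exists_succAbove_eq hij.ne'
    -- `ψ` identifies `F ^ n` with the omitted subring by inserting the conjugate of coordinate `k`
    -- at position `i`.
    let ψ : (Fin n → F) →+* (Fin (n + 1) → F) :=
      RingHom.pi fun l => Fin.succAboveCases (α := fun _ => (Fin n → F) →+* F) i
        ((φ : F →+* F).comp (Pi.evalRingHom _ k)) (fun m => Pi.evalRingHom _ m) l
    have hψi (y) : ψ y i = φ (y k) := by simp [ψ]
    have hψ (y m) : ψ y (i.succAbove m) = y m := by simp [ψ]
    have hC' : IsCover ((fun M => M.comap ψ) '' C) := by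
      refine ⟨?_, fun x => ?_⟩
      · rintro _ ⟨M, hM, rfl⟩ htop
        have hle : conjugateSubring i (i.succAbove k) φ ≤ M := by
          intro x hx
          have hmem : (fun m => x (i.succAbove m)) ∈ M.comap ψ :=
            htop.ge (NonUnitalSubring.mem_top _)
          have : x = ψ fun m => x (i.succAbove m) := by
            ext l
            refine Fin.succAboveCases i ?_ (fun m => ?_) l
            · rw [hψi]; exact hx
            · rw [hψ]
          rw [this]
          exact hmem
        rcases hle.eq_or_lt with heq | hlt
        · exact hD (heq ▸ hM)
        · exact hC.1 M hM (eq_top_of_conjugateSubring_lt hij.ne hlt)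
      · obtain ⟨M, hM, hx⟩ := hC.2 (ψ x)
        exact ⟨_, ⟨M, hM, rfl⟩, hx⟩
    exact hC'.coveringNumber_le.trans (WithTop.coe_le_coe.2 (Set.encard_image_le _ _))

theorem coveringNumber_pi_fin_mono (hf : Module.finrank (ZMod p) F = f) {m n : ℕ}
    (hm : tau p f ≤ m) (hmn : m ≤ n) :
    coveringNumber (Fin m → F) ≤ coveringNumber (Fin n → F) := by
  induction n, hmn using Nat.le_induction with
  | base => exact le_rfl
  | succ n hmn ih => exact ih.trans (coveringNumber_pi_fin_le_succ hf (hm.trans hmn))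

theorem coveringNumber_pi_ne_top (hf : Module.finrank (ZMod p) F = f) {n : ℕ}
    (hn : tau p f ≤ n) : coveringNumber (Fin n → F) ≠ ⊤ := by
  have := (isCover_fixedSubring_conjugateSubring (F := F) hf (ι := Fin n)
    (by simpa using hn)).coveringNumber_le
  exact (this.trans_lt (WithTop.coe_lt_top _)).ne

end PiCovers

/-! ### Comparing covering numbers of quotients. -/

section Quotients

variable {R : Type*} [CommRing R]

/-- Passing from a quotient by `I` to a quotient by a larger ideal `J` does not increase the
covering number if each element can be lifted modulo `J` to one whose subring contains an element
that is nilpotent modulo `I` and generates `J` modulo `I`. -/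
theorem coveringNumber_quotient_le_of_lifts {I J : Ideal R}
    (h : ∀ x, ∃ y z : R, y - x ∈ J ∧ z ∈ NonUnitalSubring.closure {y} ∧
      J ≤ Ideal.span {z} ⊔ I ∧ ∃ n, z ^ n ∈ I) :
    coveringNumber (R ⧸ J) ≤ coveringNumber (R ⧸ I) := by
  refine le_coveringNumber fun C hC => ?_
  let D : Set (NonUnitalSubring (R ⧸ J)) :=
    {N ∈ (fun M => (M.comap (Ideal.Quotient.mk I)).map (Ideal.Quotient.mk J)) '' C | N ≠ ⊤}
  have hD : D.encard ≤ C.encard :=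
    (Set.encard_le_encard (Set.sep_subset _ _)).trans (Set.encard_image_le _ _)
  suffices IsCover D from this.coveringNumber_le.trans (WithTop.coe_le_coe.2 hD)
  refine ⟨fun N hN => hN.2, fun x => ?_⟩
  obtain ⟨x, rfl⟩ := Ideal.Quotient.mk_surjective x
  obtain ⟨y, z, hyx, hz, hJ, n, hn⟩ := h x
  obtain ⟨M, hM, hyM⟩ := hC.2 (Ideal.Quotient.mk I y)
  refine ⟨_, ⟨⟨M, hM, rfl⟩, fun htop => ?_⟩,
    NonUnitalSubring.mem_map.2 ⟨y, hyM, Ideal.Quotient.eq.2 hyx⟩⟩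
  have hI (a) (ha : a ∈ I) : a ∈ M.comap (Ideal.Quotient.mk I) := by
    rw [NonUnitalSubring.mem_comap, Ideal.Quotient.eq_zero_iff_mem.2 ha]
    exact M.zero_mem
  have hzM : z ∈ M.comap (Ideal.Quotient.mk I) :=
    NonUnitalSubring.closure_le.2 (by simpa using hyM) hz
  have hMtop : M.comap (Ideal.Quotient.mk I) = ⊤ := by
    refine eq_top_of_map_mk_eq_top (z := z) (n := n) (fun m hm => mul_mem hzM hm)
      (fun x => hI _ (I.mul_mem_right x hn)) (map_mk_eq_top_iff.2 fun x => ?_)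
    obtain ⟨m, hm, hmx⟩ := map_mk_eq_top_iff.1 htop x
    obtain ⟨a, ha, b, hb, hab⟩ := Submodule.mem_sup.1 (hJ hmx)
    refine ⟨m - b, sub_mem hm (hI b hb), ?_⟩
    rwa [show m - b - x = a by linear_combination -hab]
  refine hC.1 M hM (eq_top_iff.2 fun y _ => ?_)
  obtain ⟨x, rfl⟩ := Ideal.Quotient.mk_surjective y
  exact hMtop.ge (NonUnitalSubring.mem_top x)

/-- This is CRT carried out inside `M`: products of the elements `e` play the role of idempotents,
without assuming `1 ∈ M`. -/
theorem exists_mem_sub_mem_iInf {ι : Type*} [Finite ι] {I : ι → Ideal R} {M : NonUnitalSubring R}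
    (hM : ∀ k, M.map (Ideal.Quotient.mk (I k)) = ⊤)
    (he : ∀ k l, k ≠ l → ∃ e ∈ M, e ∈ I l ∧ e - 1 ∈ I k) (x : R) :
    ∃ m ∈ M, m - x ∈ ⨅ k, I k := by
  classical
  have key (a : ι) (s : Finset ι) (ha : a ∉ s) (c : R) (hc : c ∈ M) :
      ∃ w ∈ M, w - c ∈ I a ∧ ∀ k ∈ s, w ∈ I k := by
    induction s using Finset.induction_on with
    | empty => exact ⟨c, hc, by simp, by simp⟩
    | insert b s hb ih =>
      rw [Finset.mem_insert, not_or] at ha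
      obtain ⟨w, hw, hwa, hws⟩ := ih ha.2
      obtain ⟨e, heM, heb, hea⟩ := he a b ha.1
      refine ⟨e * w, M.mul_mem heM hw, ?_, fun k hk => ?_⟩
      · rw [show e * w - c = w * (e - 1) + (w - c) by ring]
        exact add_mem (Ideal.mul_mem_left _ _ hea) hwa
      · rcases Finset.mem_insert.1 hk with rfl | hk
        · exact Ideal.mul_mem_right _ _ heb
        · exact Ideal.mul_mem_left _ _ (hws k hk)
  have hs (s : Finset ι) : ∃ m ∈ M, ∀ k ∈ s, m - x ∈ I k := by
    induction s using Finset.induction_on with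
    | empty => exact ⟨0, M.zero_mem, by simp⟩
    | insert a s ha ih =>
      obtain ⟨m, hm, hms⟩ := ih
      obtain ⟨c, hc, hcx⟩ := map_mk_eq_top_iff.1 (hM a) (x - m)
      obtain ⟨w, hw, hwa, hws⟩ := key a s ha c hc
      refine ⟨m + w, M.add_mem hm hw, fun k hk => ?_⟩
      rcases Finset.mem_insert.1 hk with rfl | hk
      · rw [show m + w - x = (w - c) + (c - (x - m)) by ring]
        exact add_mem hwa hcx
      · rw [show m + w - x = (m - x) + w by ring]
        exact add_mem (hms k hk) (hws k hk)
  cases nonempty_fintype ι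
  obtain ⟨m, hm, h⟩ := hs Finset.univ
  exact ⟨m, hm, Ideal.mem_iInf.2 fun k => h k (Finset.mem_univ k)⟩

theorem exists_coveringNumber_quotient_le {J : Ideal R} (hJ : coveringNumber (R ⧸ J) ≠ ⊤)
    {ι : Type*} [Finite ι] {I : ι → Ideal R} (hI : Pairwise (Function.onFun IsCoprime I))
    (h : ∀ M : NonUnitalSubring R, (∀ x ∈ J, x ∈ M) →
      (∀ k, M.map (Ideal.Quotient.mk (I k)) = ⊤) → M = ⊤) :
    ∃ k, coveringNumber (R ⧸ I k) ≤ coveringNumber (R ⧸ J) := by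
  obtain ⟨C, hC, hcard⟩ := exists_isCover_encard_eq hJ
  have hC' := hC.comap (Ideal.Quotient.mk_surjective (I := J))
  obtain ⟨k, hk⟩ := hC'.exists_coveringNumber_quotient_le hI fun M hM => by
    by_contra! hcon
    refine hC'.1 M hM (h M (fun x hx => ?_) hcon)
    obtain ⟨N, hN, rfl⟩ := hM
    rw [NonUnitalSubring.mem_comap, Ideal.Quotient.eq_zero_iff_mem.2 hx]
    exact N.zero_mem
  refine ⟨k, hk.trans ?_⟩
  rw [← hcard]
  exact WithTop.coe_le_coe.2 (Set.encard_image_le _ _)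

end Quotients

/-- Frobenius has order exactly `f` on `k`. -/
theorem FiniteField.exists_pow_pow_ne {k : Type*} [Field k] [Finite k] {p f f' : ℕ}
    [Fact p.Prime] (hk : Nat.card k = p ^ f) (hf : ¬ f ∣ f') : ∃ a : k, a ^ p ^ f' ≠ a := by
  by_contra! hcon
  cases nonempty_fintype k
  rw [Nat.card_eq_fintype_card] at hk
  have hp : CharP k p := by
    obtain ⟨q, hq⟩ := CharP.exists k
    obtain ⟨n, hqp, hn⟩ := FiniteField.card k q
    have : q = p := by
      have : q ∣ p ^ f := hk ▸ hn ▸ dvd_pow_self q n.2.ne'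
      exact (Nat.prime_dvd_prime_iff_eq hqp Fact.out).1 (hqp.dvd_of_dvd_pow this)
    exact this ▸ hq
  let := ZMod.algebra k p
  refine hf ?_
  have hfr : Module.finrank (ZMod p) k = f := by
    have := Module.card_eq_pow_finrank (K := ZMod p) (V := k)
    rw [hk, ZMod.card] at this
    exact (Nat.pow_right_injective (Fact.out : p.Prime).two_le this).symm
  rw [← hfr, ← FiniteField.orderOf_frobeniusAlgHom (ZMod p) k]
  refine orderOf_dvd_of_pow_eq_one (AlgHom.ext fun a => ?_)
  rw [AlgHom.coe_pow, FiniteField.coe_frobeniusAlgHom, pow_iterate, ZMod.card, AlgHom.one_apply]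
  exact hcon a

theorem Ideal.le_of_forall_not_le_mul {R : Type*} [CommRing R] [IsDedekindDomain R]
    {B J : Ideal R} (hBJ : B ≤ J) (h : ∀ P : Ideal R, P.IsMaximal → ¬ B ≤ J * P) : J ≤ B := by
  obtain ⟨Q, rfl⟩ := Ideal.dvd_iff_le.2 hBJ
  by_contra hne
  have hQ : Q ≠ ⊤ := by
    rintro rfl
    exact hne (Ideal.mul_top J).ge
  obtain ⟨P, hP, hQP⟩ := Ideal.exists_le_maximal Q hQ
  exact h P hP (Ideal.mul_mono_right hQP)

/-! ### From `A/pA` to the residue fields of one degree. -/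

section Primes

variable {K : Type*} [Field K] [NumberField K] {p : ℕ} [hp : Fact p.Prime]

theorem isMaximal_of_mem_primesOfDegree {f : ℕ} {P : Ideal (𝓞 K)} (hP : P ∈ primesOfDegree K p f) :
    P.IsMaximal := by
  have hpz : Prime (p : ℤ) := Nat.prime_iff_prime_int.1 hp.out
  have := hP.1
  have := hP.2.1
  have : (Ideal.span {(p : ℤ)}).IsMaximal :=
    PrincipalIdealRing.isMaximal_of_irreducible hpz.irreducible
  exact Ideal.IsMaximal.of_liesOver_isMaximal P (Ideal.span {(p : ℤ)})

theorem natCast_mem_of_mem_primesOfDegree {f : ℕ} {P : Ideal (𝓞 K)}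
    (hP : P ∈ primesOfDegree K p f) : (p : 𝓞 K) ∈ P := by
  have := hP.2.1
  have h : (p : ℤ) ∈ P.under ℤ := by
    rw [← Ideal.over_def P (Ideal.span {(p : ℤ)})]
    exact Ideal.mem_span_singleton_self _
  simpa [Ideal.mem_comap] using h

theorem ne_bot_of_mem_primesOfDegree {f : ℕ} {P : Ideal (𝓞 K)} (hP : P ∈ primesOfDegree K p f) :
    P ≠ ⊥ := by
  rintro rfl
  have := natCast_mem_of_mem_primesOfDegree hP
  rw [Ideal.mem_bot, Nat.cast_eq_zero] at this
  exact hp.out.ne_zero this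

theorem mem_primesOfDegree_of_natCast_mem {P : Ideal (𝓞 K)} (hP : P.IsPrime)
    (h : (p : 𝓞 K) ∈ P) : P ∈ primesOfDegree K p (P.inertiaDeg ℤ) := by
  refine ⟨hP, ⟨?_⟩, rfl⟩
  have hpz : Prime (p : ℤ) := Nat.prime_iff_prime_int.1 hp.out
  have : (Ideal.span {(p : ℤ)}).IsMaximal :=
    PrincipalIdealRing.isMaximal_of_irreducible hpz.irreducible
  refine this.eq_of_le (Ideal.IsPrime.under ℤ P).ne_top ?_
  rw [Ideal.span_singleton_le_iff_mem]
  simpa [Ideal.mem_comap] using h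

theorem natCard_quotient_of_mem_primesOfDegree {f : ℕ} {P : Ideal (𝓞 K)}
    (hP : P ∈ primesOfDegree K p f) : Nat.card (𝓞 K ⧸ P) = p ^ f := by
  have := hP.1
  have := hP.2.1
  rw [← hP.2.2, Ideal.pow_inertiaDeg p P, Ideal.absNorm_apply, Submodule.cardQuot_apply]

theorem pos_of_mem_primesOfDegree {f : ℕ} {P : Ideal (𝓞 K)} (hP : P ∈ primesOfDegree K p f) :
    0 < f := by
  have := hP.1
  exact hP.2.2 ▸ Ideal.inertiaDeg_pos P ℤ

theorem Set.Nonempty.ne_zero_of_primesOfDegree {f : ℕ}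
    (h : (primesOfDegree K p f).Nonempty) : f ≠ 0 :=
  let ⟨_, hP⟩ := h
  (pos_of_mem_primesOfDegree hP).ne'

theorem finite_primesOver_span : ((Ideal.span {(p : ℤ)}).primesOver (𝓞 K)).Finite :=
  Algebra.QuasiFinite.finite_primesOver _

theorem finite_primesOfDegree {f : ℕ} : (primesOfDegree K p f).Finite :=
  finite_primesOver_span.subset fun _ hP => ⟨hP.1, hP.2.1⟩

theorem numPrimes_le_finrank {f : ℕ} : numPrimes K p f ≤ Module.finrank ℤ (𝓞 K) := by
  have hpz : Prime (p : ℤ) := Nat.prime_iff_prime_int.1 hp.out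
  have : (Ideal.span {(p : ℤ)}).IsPrime := (Ideal.span_singleton_prime hpz.ne_zero).2 hpz
  have := (finite_primesOver_span (K := K) (p := p)).fintype
  calc numPrimes K p f ≤ ((Ideal.span {(p : ℤ)}).primesOver (𝓞 K)).ncard :=
        Set.ncard_le_ncard (fun _ hP => ⟨hP.1, hP.2.1⟩) finite_primesOver_span
    _ = ∑ _q : (Ideal.span {(p : ℤ)}).primesOver (𝓞 K), 1 := by
        rw [← Nat.card_coe_set_eq, Nat.card_eq_fintype_card]; simp
    _ ≤ ∑ q : (Ideal.span {(p : ℤ)}).primesOver (𝓞 K),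
          q.1.ramificationIdx ℤ * q.1.inertiaDeg ℤ := by
        refine Finset.sum_le_sum fun q _ => ?_
        have := q.2.1
        exact Nat.mul_pos (Ideal.ramificationIdx_pos q.1 ℤ) (Ideal.inertiaDeg_pos q.1 ℤ)
    _ = Module.finrank ℤ (𝓞 K) := Ideal.sum_ramification_inertia_eq_finrank _ _

theorem exists_ringEquiv_galoisField {f : ℕ} {P : Ideal (𝓞 K)} (hP : P ∈ primesOfDegree K p f) :
    Nonempty (𝓞 K ⧸ P ≃+* GaloisField p f) := by
  have hmax := isMaximal_of_mem_primesOfDegree hP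
  have hf := pos_of_mem_primesOfDegree hP
  let := Ideal.Quotient.field P
  have hcard := natCard_quotient_of_mem_primesOfDegree hP
  have : Finite (𝓞 K ⧸ P) := Nat.finite_of_card_ne_zero (by
    rw [hcard]; exact pow_ne_zero _ hp.out.ne_zero)
  have := Fintype.ofFinite (𝓞 K ⧸ P)
  have := Fintype.ofFinite (GaloisField p f)
  refine ⟨FiniteField.ringEquivOfCardEq ?_⟩
  rw [← Nat.card_eq_fintype_card, ← Nat.card_eq_fintype_card, hcard, GaloisField.card _ _ hf.ne']

theorem coveringNumber_pi_quotient {f : ℕ} {ι : Type*} [Finite ι] {P : ι → Ideal (𝓞 K)}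
    (hP : ∀ i, P i ∈ primesOfDegree K p f) :
    coveringNumber (∀ i, 𝓞 K ⧸ P i) = coveringNumber (Fin (Nat.card ι) → GaloisField p f) := by
  rw [coveringNumber_congr
    (RingEquiv.piCongrRight fun i => (exists_ringEquiv_galoisField (hP i)).some)]
  exact coveringNumber_congr
    (RingEquiv.piCongrLeft (fun _ => GaloisField p f) (Finite.equivFin ι))

theorem isCoprime_of_mem_primesOfDegree {f f' : ℕ} {P Q : Ideal (𝓞 K)}
    (hP : P ∈ primesOfDegree K p f) (hQ : Q ∈ primesOfDegree K p f') (h : P ≠ Q) :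
    IsCoprime P Q := by
  have := isMaximal_of_mem_primesOfDegree hP
  have := isMaximal_of_mem_primesOfDegree hQ
  exact Ideal.isCoprime_of_isMaximal h

/-- The product of the primes over `p` of residual degree `f`. -/
noncomputable def degreeIdeal (K : Type*) [Field K] [NumberField K] (p f : ℕ) : Ideal (𝓞 K) :=
  ⨅ P : primesOfDegree K p f, P.1

theorem coveringNumber_quotient_iInf {f : ℕ} {ι : Type*} [Finite ι] {P : ι → Ideal (𝓞 K)}
    (hP : ∀ i, P i ∈ primesOfDegree K p f) (hinj : Function.Injective P) :
    coveringNumber (𝓞 K ⧸ ⨅ i, P i) = coveringNumber (Fin (Nat.card ι) → GaloisField p f) := by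
  rw [← coveringNumber_pi_quotient hP]
  exact coveringNumber_congr (Ideal.quotientInfRingEquivPiQuotient P fun i j hij =>
    isCoprime_of_mem_primesOfDegree (hP i) (hP j) (hinj.ne hij))

theorem coveringNumber_quotient_degreeIdeal {f : ℕ} :
    coveringNumber (𝓞 K ⧸ degreeIdeal K p f) =
      coveringNumber (Fin (numPrimes K p f) → GaloisField p f) := by
  have : Finite (primesOfDegree K p f) := finite_primesOfDegree
  rw [degreeIdeal, coveringNumber_quotient_iInf (fun i => i.2) Subtype.val_injective,
    numPrimes, Nat.card_coe_set_eq]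

theorem mem_degreeIdeal {f : ℕ} {x : 𝓞 K} :
    x ∈ degreeIdeal K p f ↔ ∀ P ∈ primesOfDegree K p f, x ∈ P := by
  simp [degreeIdeal]

theorem mem_radical_iff {x : 𝓞 K} :
    x ∈ (Ideal.span {(p : 𝓞 K)}).radical ↔ ∀ f, ∀ P ∈ primesOfDegree K p f, x ∈ P := by
  rw [Ideal.radical_eq_sInf, Ideal.mem_sInf]
  constructor
  · intro h f P hP
    exact h ⟨(Ideal.span_singleton_le_iff_mem _).2 (natCast_mem_of_mem_primesOfDegree hP), hP.1⟩
  · intro h P hP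
    exact h _ P (mem_primesOfDegree_of_natCast_mem hP.2
      ((Ideal.span_singleton_le_iff_mem _).1 hP.1))

theorem pow_pow_mul_sub_mem {f : ℕ} {P : Ideal (𝓞 K)} (hP : P ∈ primesOfDegree K p f) (n : ℕ)
    (x : 𝓞 K) : x ^ p ^ (f * n) - x ∈ P := by
  have := isMaximal_of_mem_primesOfDegree hP
  have hcard := natCard_quotient_of_mem_primesOfDegree hP
  let := Ideal.Quotient.field P
  have : Finite (𝓞 K ⧸ P) := Nat.finite_of_card_ne_zero (by
    rw [hcard]; exact pow_ne_zero _ hp.out.ne_zero)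
  have := Fintype.ofFinite (𝓞 K ⧸ P)
  rw [← Ideal.Quotient.eq, map_pow, pow_mul, ← hcard, Nat.card_eq_fintype_card,
    FiniteField.pow_card_pow]

/-- Each element can be changed modulo all primes over `p` so that the difference of a suitable
power and the element itself is a simultaneous uniformizer. -/
theorem exists_lift (x : 𝓞 K) : ∃ y z : 𝓞 K, y - x ∈ (Ideal.span {(p : 𝓞 K)}).radical ∧
    z ∈ NonUnitalSubring.closure {y} ∧
    (Ideal.span {(p : 𝓞 K)}).radical ≤ Ideal.span {z} ⊔ Ideal.span {(p : 𝓞 K)} ∧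
    ∃ n, z ^ n ∈ Ideal.span {(p : 𝓞 K)} := by
  let ι := (Ideal.span {(p : ℤ)}).primesOver (𝓞 K)
  have hι : Finite ι := finite_primesOver_span
  cases nonempty_fintype ι
  have hdeg (P : ι) : P.1 ∈ primesOfDegree K p (P.1.inertiaDeg ℤ) := ⟨P.2.1, P.2.2, rfl⟩
  -- Any common multiple of the residual degrees would do: the `p ^ N`-th power is then the identity
  -- on every residue field over `p`.
  let N := ∏ P : ι, P.1.inertiaDeg ℤ
  have hN : N ≠ 0 := Finset.prod_ne_zero_iff.2 fun P _ => (pos_of_mem_primesOfDegree (hdeg P)).ne'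
  have hpow {f : ℕ} {P : Ideal (𝓞 K)} (hP : P ∈ primesOfDegree K p f) (x : 𝓞 K) :
      x ^ p ^ N - x ∈ P := by
    obtain ⟨n, hn⟩ : f ∣ N := by
      have := Finset.dvd_prod_of_mem (fun P : ι => P.1.inertiaDeg ℤ)
        (Finset.mem_univ (⟨P, hP.1, hP.2.1⟩ : ι))
      rwa [show (⟨P, hP.1, hP.2.1⟩ : ι).1.inertiaDeg ℤ = f from hP.2.2] at this
    rw [hn]
    exact pow_pow_mul_sub_mem hP n x
  have hw (P : ι) : ∃ w, w - x ∈ P.1 ∧ w ^ p ^ N - w ∉ P.1 ^ 2 := by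
    -- The derivative of `X ^ p ^ N - X` is `-1` modulo `P`, so adding some `t` in `P` but not in `P
    -- ^ 2` to `x` moves the value out of `P ^ 2`.
    by_cases hx : x ^ p ^ N - x ∈ P.1 ^ 2
    · have hmax := isMaximal_of_mem_primesOfDegree (hdeg P)
      obtain ⟨t, ht, ht2⟩ := Ideal.exists_mem_pow_notMem_pow_succ P.1
        (ne_bot_of_mem_primesOfDegree (hdeg P)) hmax.ne_top 1
      rw [pow_one] at ht
      refine ⟨x + t, by simpa using ht, fun hmem => ht2 ?_⟩
      have htt : t ^ 2 ∈ P.1 ^ 2 := Ideal.pow_mem_pow ht 2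
      have hpt : (p : 𝓞 K) * t ∈ P.1 ^ 2 := by
        rw [sq]
        exact Ideal.mul_mem_mul (natCast_mem_of_mem_primesOfDegree (hdeg P)) ht
      obtain ⟨M, hM⟩ := Nat.exists_eq_succ_of_ne_zero hN
      obtain ⟨c, hc⟩ := (Polynomial.powAddExpansion x t (p ^ N))
      have hcast : ((p ^ N : ℕ) : 𝓞 K) = p * p ^ M := by
        rw [hM, Nat.succ_eq_add_one, pow_succ]; push_cast; ring
      have : t = (x ^ p ^ N - x) + (x ^ (p ^ N - 1) * p ^ M) * (p * t) + c * t ^ 2 -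
          ((x + t) ^ p ^ N - (x + t)) := by
        rw [hc, hcast]; ring
      rw [this]
      exact sub_mem (add_mem (add_mem hx (Ideal.mul_mem_left _ _ hpt))
        (Ideal.mul_mem_left _ _ htt)) hmem
    · exact ⟨x, by simp, hx⟩
  choose w hwx hw2 using hw
  obtain ⟨y, hy⟩ := Ideal.exists_forall_sub_mem_ideal (I := fun P : ι => P.1 ^ 2)
    (fun P Q hPQ => (isCoprime_of_mem_primesOfDegree (hdeg P) (hdeg Q)
      (Subtype.coe_injective.ne hPQ)).pow) w
  have hy1 (P : ι) : y - x ∈ P.1 := by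
    rw [show y - x = (y - w P) + (w P - x) by ring]
    exact add_mem (Ideal.pow_le_self two_ne_zero (hy P)) (hwx P)
  have hz2 (P : ι) : y ^ p ^ N - y ∉ P.1 ^ 2 := by
    intro h
    apply hw2 P
    have h1 : y ^ p ^ N - w P ^ p ^ N ∈ P.1 ^ 2 :=
      Ideal.mem_of_dvd _ (sub_dvd_pow_sub_pow _ _ _) (hy P)
    rw [show w P ^ p ^ N - w P = (y ^ p ^ N - y) - (y ^ p ^ N - w P ^ p ^ N) + (y - w P) by ring]
    exact add_mem (sub_mem h h1) (hy P)
  have hzrad : y ^ p ^ N - y ∈ (Ideal.span {(p : 𝓞 K)}).radical :=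
    mem_radical_iff.2 fun f P hP => hpow hP y
  refine ⟨y, y ^ p ^ N - y, mem_radical_iff.2 fun f P hP => hy1 ⟨P, hP.1, hP.2.1⟩, ?_, ?_, hzrad⟩
  · have hymem := NonUnitalSubring.subset_closure (Set.mem_singleton y)
    refine sub_mem ?_ hymem
    obtain ⟨k, hk⟩ := Nat.exists_eq_succ_of_ne_zero (pow_ne_zero N hp.out.ne_zero)
    rw [hk]
    clear hk
    induction k with
    | zero => simpa using hymem
    | succ k ih => rw [pow_succ]; exact mul_mem ih hymem
  · set J := (Ideal.span {(p : 𝓞 K)}).radical with hJ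
    set B := Ideal.span {y ^ p ^ N - y} ⊔ Ideal.span {(p : 𝓞 K)} with hB
    have hBJ : B ≤ J := sup_le ((Ideal.span_singleton_le_iff_mem _).2 hzrad) Ideal.le_radical
    have hpB : (p : 𝓞 K) ∈ B := Ideal.mem_sup_right (Ideal.mem_span_singleton_self _)
    have hzB : y ^ p ^ N - y ∈ B := Ideal.mem_sup_left (Ideal.mem_span_singleton_self _)
    -- If `B` were strictly smaller than the radical `J`, it would lie in some `J * P` with `P` over
    -- `p`, forcing `y ^ p ^ N - y` into `P ^ 2`.
    refine Ideal.le_of_forall_not_le_mul hBJ fun P hP hBP => ?_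
    have hBP' : B ≤ P := hBP.trans Ideal.mul_le_right
    have hPmem : P ∈ primesOfDegree K p (P.inertiaDeg ℤ) :=
      mem_primesOfDegree_of_natCast_mem hP.isPrime (hBP' hpB)
    refine hz2 ⟨P, hPmem.1, hPmem.2.1⟩ ?_
    rw [sq]
    have hJP : J ≤ P := fun a ha => mem_radical_iff.1 ha _ P hPmem
    exact hBP.trans (Ideal.mul_mono_left hJP) hzB

theorem coveringNumber_quotient_radical_le :
    coveringNumber (𝓞 K ⧸ (Ideal.span {(p : 𝓞 K)}).radical) ≤
      coveringNumber (𝓞 K ⧸ Ideal.span {(p : 𝓞 K)}) :=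
  coveringNumber_quotient_le_of_lifts exists_lift

/-- `X ^ p ^ f' - X` vanishes on residue fields of degree `f'` but not identically on those of
degree `f`. A nonzero value at each prime of degree `f`, raised to the power `p ^ f - 1`, becomes 1.
-/
theorem exists_sub_one_mem_degreeIdeal {M : NonUnitalSubring (𝓞 K)} {f f' : ℕ} (hf : f ≠ 0)
    (hff : ¬ f ∣ f')
    (hM : M.map (Ideal.Quotient.mk (degreeIdeal K p f)) = ⊤) :
    ∃ e ∈ M, e ∈ degreeIdeal K p f' ∧ e - 1 ∈ degreeIdeal K p f := by
  have : Finite (primesOfDegree K p f) := finite_primesOfDegree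
  have ha (P : primesOfDegree K p f) : ∃ a : 𝓞 K ⧸ P.1, a ^ p ^ f' ≠ a := by
    have := isMaximal_of_mem_primesOfDegree P.2
    have hcard := natCard_quotient_of_mem_primesOfDegree P.2
    let := Ideal.Quotient.field P.1
    have : Finite (𝓞 K ⧸ P.1) := Nat.finite_of_card_ne_zero (by
      rw [hcard]; exact pow_ne_zero _ hp.out.ne_zero)
    exact FiniteField.exists_pow_pow_ne hcard hff
  choose a ha using ha
  obtain ⟨x, hx⟩ := Ideal.pi_quotient_surjective (I := fun P : primesOfDegree K p f => P.1)
    (fun P Q hPQ => isCoprime_of_mem_primesOfDegree P.2 Q.2 (Subtype.coe_injective.ne hPQ)) a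
  obtain ⟨m, hm, hmx⟩ := map_mk_eq_top_iff.1 hM x
  have hpowM (u : 𝓞 K) (hu : u ∈ M) (k : ℕ) (hk : k ≠ 0) : u ^ k ∈ M := by
    obtain ⟨k, rfl⟩ := Nat.exists_eq_succ_of_ne_zero hk
    clear hk
    induction k with
    | zero => simpa using hu
    | succ k ih => rw [pow_succ]; exact mul_mem ih hu
  have hpf : p ^ f - 1 ≠ 0 := by
    have := Nat.one_lt_pow hf hp.out.one_lt
    omega
  have hu : m ^ p ^ f' - m ∈ M := sub_mem (hpowM m hm _ (pow_ne_zero _ hp.out.ne_zero)) hm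
  refine ⟨(m ^ p ^ f' - m) ^ (p ^ f - 1), hpowM _ hu _ hpf, ?_, ?_⟩
  · refine Ideal.pow_mem_of_mem _ (mem_degreeIdeal.2 fun P hP => ?_) _ (Nat.pos_of_ne_zero hpf)
    simpa using pow_pow_mul_sub_mem hP 1 m
  · refine mem_degreeIdeal.2 fun P hP => ?_
    have := isMaximal_of_mem_primesOfDegree hP
    have hcard := natCard_quotient_of_mem_primesOfDegree hP
    let := Ideal.Quotient.field P
    have : Finite (𝓞 K ⧸ P) := Nat.finite_of_card_ne_zero (by
      rw [hcard]; exact pow_ne_zero _ hp.out.ne_zero)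
    have := Fintype.ofFinite (𝓞 K ⧸ P)
    have hma : Ideal.Quotient.mk P m = a ⟨P, hP⟩ := by
      rw [← hx ⟨P, hP⟩]
      exact Ideal.Quotient.eq.2 (mem_degreeIdeal.1 hmx P hP)
    rw [← Ideal.Quotient.eq, map_pow, map_sub, map_pow, map_one, ← hcard,
      Nat.card_eq_fintype_card, hma]
    exact FiniteField.pow_card_sub_one_eq_one _ (sub_ne_zero.2 (ha ⟨P, hP⟩))

theorem exists_coveringNumber_degreeIdeal_le
    (h : coveringNumber (𝓞 K ⧸ (Ideal.span {(p : 𝓞 K)}).radical) ≠ ⊤) :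
    ∃ f, (primesOfDegree K p f).Nonempty ∧ coveringNumber (𝓞 K ⧸ degreeIdeal K p f) ≤
      coveringNumber (𝓞 K ⧸ (Ideal.span {(p : 𝓞 K)}).radical) := by
  have hfin : Finite {f // (primesOfDegree K p f).Nonempty} := by
    refine Set.Finite.subset
      ((finite_primesOver_span (K := K) (p := p)).image fun P => P.inertiaDeg ℤ) ?_
    rintro f ⟨P, hP⟩
    exact ⟨P, ⟨hP.1, hP.2.1⟩, hP.2.2⟩
  have hpair (f f' : ℕ) (hf : f ≠ f') (M : NonUnitalSubring (𝓞 K))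
      (hM : ∀ f : {f // (primesOfDegree K p f).Nonempty},
        M.map (Ideal.Quotient.mk (degreeIdeal K p f)) = ⊤)
      (hfne : (primesOfDegree K p f).Nonempty) (hfne' : (primesOfDegree K p f').Nonempty) :
      ∃ e ∈ M, e ∈ degreeIdeal K p f' ∧ e - 1 ∈ degreeIdeal K p f := by
    -- If `f ∣ f'`, the roles are swapped and the complement of `e` is taken; as 1 may be missing
    -- from `M`, some `m ≡ 1` modulo the degree `f` ideal replaces it.
    by_cases hdvd : f ∣ f'
    · have hdvd' : ¬ f' ∣ f := fun h => hf (Nat.dvd_antisymm hdvd h)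
      obtain ⟨e, he, hef, hef'⟩ := exists_sub_one_mem_degreeIdeal (f' := f)
        hfne'.ne_zero_of_primesOfDegree hdvd' (hM ⟨f', hfne'⟩)
      obtain ⟨m, hm, hm1⟩ := map_mk_eq_top_iff.1 (hM ⟨f, hfne⟩) 1
      refine ⟨m - m * e, sub_mem hm (mul_mem hm he), ?_, ?_⟩
      · rw [show m - m * e = (-m) * (e - 1) by ring]
        exact Ideal.mul_mem_left _ _ hef'
      · rw [show m - m * e - 1 = (m - 1) - m * e by ring]
        exact sub_mem hm1 (Ideal.mul_mem_left _ _ hef)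
    · exact exists_sub_one_mem_degreeIdeal hfne.ne_zero_of_primesOfDegree hdvd (hM ⟨f, hfne⟩)
  have hcop : Pairwise (Function.onFun IsCoprime
      fun f : {f // (primesOfDegree K p f).Nonempty} => degreeIdeal K p f) := by
    intro f f' hff
    obtain ⟨e, -, he, he'⟩ := hpair f f' (Subtype.coe_injective.ne hff) ⊤
      (fun f => map_mk_eq_top_iff.2 fun x => ⟨x, trivial, by simp⟩) f.2 f'.2
    refine Ideal.isCoprime_iff_exists.2 ⟨1 - e, ?_, e, he, by ring⟩
    simpa using neg_mem he'
  obtain ⟨f, hf⟩ := exists_coveringNumber_quotient_le h hcop fun M hMJ hM => by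
    refine eq_top_iff.2 fun x _ => ?_
    obtain ⟨m, hm, hmx⟩ := exists_mem_sub_mem_iInf hM
      (fun f f' hff => hpair f f' (Subtype.coe_injective.ne hff) M hM f.2 f'.2) x
    have : m - x ∈ (Ideal.span {(p : 𝓞 K)}).radical :=
      mem_radical_iff.2 fun f P hP => mem_degreeIdeal.1 (Ideal.mem_iInf.1 hmx ⟨f, P, hP⟩) P hP
    have := sub_mem hm (hMJ _ this)
    simpa using this
  exact ⟨f, f.2, hf⟩

theorem mem_badDegrees_of_coveringNumber_ne_top {f : ℕ} (hne : (primesOfDegree K p f).Nonempty)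
    (h : coveringNumber (𝓞 K ⧸ degreeIdeal K p f) ≠ ⊤) : f ∈ badDegrees K p := by
  refine ⟨hne, ?_⟩
  by_contra! hlt
  rw [coveringNumber_quotient_degreeIdeal] at h
  obtain ⟨P, hP⟩ := hne
  exact h (coveringNumber_pi_eq_top
    (GaloisField.finrank p (pos_of_mem_primesOfDegree hP).ne') (by simpa using hlt))

theorem exists_mem_badDegrees_coveringNumber_le
    (h : coveringNumber (𝓞 K ⧸ Ideal.span {(p : 𝓞 K)}) ≠ ⊤) :
    ∃ f ∈ badDegrees K p, coveringNumber (Fin (tau p f) → GaloisField p f) ≤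
      coveringNumber (𝓞 K ⧸ Ideal.span {(p : 𝓞 K)}) := by
  have hrad := coveringNumber_quotient_radical_le (K := K) (p := p)
  obtain ⟨f, hne, hf⟩ := exists_coveringNumber_degreeIdeal_le
    (ne_top_of_le_ne_top h hrad)
  have hf' := hf.trans hrad
  have hbad := mem_badDegrees_of_coveringNumber_ne_top hne (ne_top_of_le_ne_top h hf')
  refine ⟨f, hbad, le_trans ?_ hf'⟩
  rw [coveringNumber_quotient_degreeIdeal]
  obtain ⟨P, hP⟩ := hne
  exact coveringNumber_pi_fin_mono
    (GaloisField.finrank p (pos_of_mem_primesOfDegree hP).ne') le_rfl hbad.2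

end Primes

/-! ### From a finite cover to one prime number. -/

section Primes

variable {R : Type*} [CommRing R]

/-- If `M + pR = R` for all primes `p ∣ n`, then `M + dR = R` for all `d ∣ n` by multiplicativity;
`d = n` gives `M = R`. -/
theorem NonUnitalSubring.exists_prime_map_mk_ne_top {M : NonUnitalSubring R} (hM : M ≠ ⊤) {n : ℕ}
    (hn : n ≠ 0) (hnM : ∀ x, (n : R) * x ∈ M) :
    ∃ p : ℕ, p.Prime ∧ p ∣ n ∧ M.map (Ideal.Quotient.mk (Ideal.span {(p : R)})) ≠ ⊤ := by
  by_contra! hcon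
  have key (d : ℕ) : d ∣ n → ∀ x, ∃ m ∈ M, m - x ∈ Ideal.span {(d : R)} := by
    induction d using induction_on_primes with
    | zero => exact fun h => (hn (zero_dvd_iff.1 h)).elim
    | one => exact fun _ x => ⟨0, M.zero_mem, by simp⟩
    | prime_mul p a hp ih =>
      intro hd x
      obtain ⟨m, hm, hmx⟩ := map_mk_eq_top_iff.1 (hcon p hp ((Dvd.intro _ rfl).trans hd)) x
      obtain ⟨c, hc⟩ := Ideal.mem_span_singleton'.1 hmx
      obtain ⟨m', hm', hmc⟩ := ih ((Dvd.intro_left _ rfl).trans hd) c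
      obtain ⟨e, he⟩ := Ideal.mem_span_singleton'.1 hmc
      refine ⟨m - p • m', M.sub_mem hm (nsmul_mem hm' p), Ideal.mem_span_singleton'.2 ⟨-e, ?_⟩⟩
      rw [nsmul_eq_mul]
      push_cast
      linear_combination hc - (p : R) * he
  refine hM (eq_top_iff.2 fun x _ => ?_)
  obtain ⟨m, hm, hmx⟩ := key n dvd_rfl x
  obtain ⟨c, hc⟩ := Ideal.mem_span_singleton'.1 hmx
  rw [show x = m - n * c by linear_combination hc]
  exact M.sub_mem hm (hnM c)

/-- By B. H. Neumann's lemma, the members of infinite index of a finite cover can be omitted. -/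
theorem IsCover.filter_finiteIndex {C : Set (NonUnitalSubring R)} (hC : IsCover C)
    (hfin : C.Finite) : IsCover {M ∈ C | M.toAddSubgroup.FiniteIndex} := by
  classical
  refine ⟨fun M hM => hC.1 M hM.1, fun x => ?_⟩
  have h := AddSubgroup.leftCoset_cover_filter_FiniteIndex (G := R)
    (H := fun M : NonUnitalSubring R => M.toAddSubgroup) (g := fun _ => 0) (s := hfin.toFinset) (by
      refine Set.eq_univ_of_forall fun x => ?_
      obtain ⟨M, hM, hx⟩ := hC.2 x
      simp only [Set.mem_iUnion]
      exact ⟨M, hfin.mem_toFinset.2 hM, x, hx, zero_add x⟩)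
  have hx := h.ge (Set.mem_univ x)
  simp only [Set.mem_iUnion, Finset.mem_filter, Set.Finite.mem_toFinset] at hx
  obtain ⟨M, ⟨hM, hMfin⟩, y, hy, rfl⟩ := hx
  exact ⟨M, ⟨hM, hMfin⟩, by simpa using hy⟩

theorem exists_prime_coveringNumber_quotient_le (h : coveringNumber R < coverInfty) :
    ∃ p : ℕ, p.Prime ∧ coveringNumber (R ⧸ Ideal.span {(p : R)}) ≤ coveringNumber R := by
  obtain ⟨C, hC, hcard⟩ := exists_isCover_encard_eq (lt_coverInfty_iff.1 h).1
  have hfin : C.Finite := by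
    rw [← hcard] at h
    exact Set.encard_lt_top_iff.1 (WithTop.coe_lt_coe.1 h)
  have hC' := hC.filter_finiteIndex hfin
  let ι := {p : ℕ | p.Prime ∧ ∃ M ∈ {M ∈ C | M.toAddSubgroup.FiniteIndex},
    p ∣ M.toAddSubgroup.index}
  have hι : Finite ι := by
    refine Set.Finite.subset (hfin.biUnion fun M _ => M.toAddSubgroup.index.primeFactors.finite_toSet)
      ?_
    rintro p ⟨hp, M, hM, hpM⟩
    exact Set.mem_biUnion hM.1 (Nat.mem_primeFactors.2 ⟨hp, hpM, hM.2.index_ne_zero⟩)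
  have hcop : Pairwise (Function.onFun IsCoprime
      fun p : ι => Ideal.span {((p : ℕ) : R)}) := by
    intro p q hpq
    rw [Function.onFun, Ideal.isCoprime_span_singleton_iff]
    have := (Nat.isCoprime_iff_coprime.2 ((Nat.coprime_primes p.2.1 q.2.1).2
      (Subtype.coe_injective.ne hpq))).map (Int.castRingHom R)
    simpa using this
  obtain ⟨k, hk⟩ := hC'.exists_coveringNumber_quotient_le hcop fun M hM => by
    obtain ⟨p, hp, hpn, hpM⟩ := NonUnitalSubring.exists_prime_map_mk_ne_top (hC'.1 M hM)
      hM.2.index_ne_zero fun x => by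
        rw [← nsmul_eq_mul]
        exact M.toAddSubgroup.nsmul_index_mem x
    exact ⟨⟨p, hp, M, hM, hpn⟩, hpM⟩
  refine ⟨k, k.2.1, hk.trans ?_⟩
  rw [← hcard]
  exact WithTop.coe_le_coe.2 (Set.encard_le_encard (Set.sep_subset _ _))

end Primes

/-! ### Indices of the orders `ℤ[θ]`. -/

section Index

variable {K : Type*} [Field K] [NumberField K]

theorem indexOf_nsmul_mem (θ x : 𝓞 K) : indexOf θ • x ∈ Algebra.adjoin ℤ {θ} :=
  AddSubgroup.nsmul_index_mem (Subalgebra.toSubmodule (Algebra.adjoin ℤ {θ})).toAddSubgroup x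

/-- Both maps agree on `ℤ[θ]`, which contains all multiples by the index, and the index is
invertible in `k`. -/
theorem ringHom_eq_of_not_dvd_indexOf {p : ℕ} {k : Type*} [Field k] [CharP k p] {θ : 𝓞 K}
    (hp : ¬ p ∣ indexOf θ) {g₁ g₂ : 𝓞 K →+* k} (h : g₁ θ = g₂ θ) : g₁ = g₂ := by
  ext x
  have hle : Algebra.adjoin ℤ {θ} ≤ AlgHom.equalizer g₁.toIntAlgHom g₂.toIntAlgHom :=
    Algebra.adjoin_le (by simpa using h)
  have hx : g₁ (indexOf θ • x) = g₂ (indexOf θ • x) := hle (indexOf_nsmul_mem θ x)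
  rw [map_nsmul, map_nsmul, nsmul_eq_mul, nsmul_eq_mul] at hx
  exact mul_left_cancel₀ (fun h0 => hp ((CharP.cast_eq_zero_iff k p _).1 h0)) hx

theorem finite_of_smul_mem_adjoin {θ : 𝓞 K} {r : ℤ} (hr : r ≠ 0)
    (h : ∀ x, r • x ∈ Algebra.adjoin ℤ {θ}) :
    Finite (𝓞 K ⧸ Subalgebra.toSubmodule (Algebra.adjoin ℤ {θ})) := by
  refine Module.finite_of_fg_torsion _ fun x => ?_
  obtain ⟨x, rfl⟩ := Submodule.Quotient.mk_surjective _ x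
  refine ⟨⟨r, mem_nonZeroDivisors_of_ne_zero hr⟩, ?_⟩
  exact (Submodule.Quotient.mk_eq_zero _).2 (h x)

theorem adjoin_eq_top_of_smul_mem_adjoin {θ : 𝓞 K} {r : ℤ} (hr : r ≠ 0)
    (h : ∀ x, r • x ∈ Algebra.adjoin ℤ {θ}) : IntermediateField.adjoin ℚ {(θ : K)} = ⊤ := by
  have hmem (x : 𝓞 K) : (x : K) ∈ IntermediateField.adjoin ℚ {(θ : K)} := by
    have hadj (y : 𝓞 K) (hy : y ∈ Algebra.adjoin ℤ {θ}) :
        (y : K) ∈ IntermediateField.adjoin ℚ {(θ : K)} := by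
      induction hy using Algebra.adjoin_induction with
      | mem y hy =>
        rw [Set.mem_singleton_iff.1 hy]
        exact IntermediateField.mem_adjoin_simple_self ℚ _
      | algebraMap n => simp
      | add y z _ _ hy hz => simpa using add_mem hy hz
      | mul y z _ _ hy hz => simpa using mul_mem hy hz
    have hx := hadj _ (h x)
    have hrK : (r : K) ≠ 0 := Int.cast_ne_zero.2 hr
    have hcoe : ((r • x : 𝓞 K) : K) = r * (x : K) := by
      rw [zsmul_eq_mul]
      simp
    rw [hcoe] at hx
    have := div_mem hx (intCast_mem (IntermediateField.adjoin ℚ {(θ : K)}) r)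
    rwa [mul_div_cancel_left₀ _ hrK] at this
  refine eq_top_iff.2 fun a _ => ?_
  obtain ⟨b, c, -, rfl⟩ := IsFractionRing.div_surjective (A := 𝓞 K) a
  exact div_mem (hmem b) (hmem c)

/-- The discriminant of the power basis of an integral primitive element carries `A` into `ℤ[θ]`, so
the index is finite. Without this, `indexOf` could be the default 0, divisible by every prime. -/
theorem exists_adjoin_eq_top_indexOf_ne_zero (K : Type*) [Field K] [NumberField K] :
    ∃ θ : 𝓞 K, IntermediateField.adjoin ℚ {(θ : K)} = ⊤ ∧ indexOf θ ≠ 0 := by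
  obtain ⟨α, hα⟩ := Field.exists_primitive_element ℚ K
  have hαalg : IsAlgebraic ℤ α :=
    (IsFractionRing.isAlgebraic_iff ℤ ℚ K).2 (IsAlgebraic.of_finite ℚ α)
  obtain ⟨m, hm, hmα⟩ := hαalg.exists_integral_multiple
  obtain ⟨θ, hθ⟩ : ∃ θ : 𝓞 K, (θ : K) = m • α := ⟨⟨m • α, hmα⟩, rfl⟩
  have hθtop : IntermediateField.adjoin ℚ {(θ : K)} = ⊤ := by
    rw [← top_le_iff, ← hα, IntermediateField.adjoin_simple_le_iff]
    have hmK : (m : K) ≠ 0 := Int.cast_ne_zero.2 hm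
    have := div_mem (IntermediateField.mem_adjoin_simple_self ℚ (θ : K))
      (intCast_mem (IntermediateField.adjoin ℚ {(θ : K)}) m)
    rwa [hθ, zsmul_eq_mul, mul_div_cancel_left₀ _ hmK, ← zsmul_eq_mul, ← hθ] at this
  have hint : IsIntegral ℚ (θ : K) := .of_finite _ _
  have htop : Algebra.adjoin ℚ {(θ : K)} = ⊤ := by
    rw [← IntermediateField.adjoin_simple_toSubalgebra_of_isAlgebraic hint.isAlgebraic, hθtop,
      IntermediateField.top_toSubalgebra]
  let B := PowerBasis.ofAdjoinEqTop' hint htop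
  have hB : B.gen = θ := PowerBasis.ofAdjoinEqTop'_gen hint htop
  let d := Algebra.discr ℚ B.basis
  have hd : d ≠ 0 := Algebra.discr_not_zero_of_basis ℚ B.basis
  have hmem (x : 𝓞 K) : d.num • x ∈ Algebra.adjoin ℤ {θ} := by
    have h1 : d • (x : K) ∈ Algebra.adjoin ℤ {(θ : K)} := by
      rw [← hB]
      exact Algebra.discr_mul_isIntegral_mem_adjoin ℚ (by rw [hB]; exact θ.isIntegral_coe)
        x.isIntegral_coe
    have h2 : d.num • (x : K) ∈ Algebra.adjoin ℤ {(θ : K)} := by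
      have := nsmul_mem h1 d.den
      rwa [← Nat.cast_smul_eq_nsmul ℚ, smul_smul, Rat.den_mul_eq_num, Int.cast_smul_eq_zsmul] at this
    have hmap : Algebra.adjoin ℤ {(θ : K)} =
        (Algebra.adjoin ℤ {θ}).map (IsScalarTower.toAlgHom ℤ (𝓞 K) K) := by
      rw [AlgHom.map_adjoin_singleton]
      rfl
    rw [hmap] at h2
    obtain ⟨y, hy, hyx⟩ := Subalgebra.mem_map.1 h2
    have : y = d.num • x := by
      apply RingOfIntegers.ext
      rw [RingOfIntegers.coe_eq_algebraMap, RingOfIntegers.coe_eq_algebraMap, map_zsmul]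
      exact hyx
    exact this ▸ hy
  refine ⟨θ, hθtop, ?_⟩
  have := finite_of_smul_mem_adjoin (Rat.num_ne_zero.2 hd) hmem
  exact (Nat.card_pos (α := 𝓞 K ⧸ Subalgebra.toSubmodule (Algebra.adjoin ℤ {θ}))).ne'

/-- For a lift `θ` of a generator of `A/pA`, the finitely generated group `A/ℤ[θ]` equals `p` times
itself, so Nakayama gives `r ≡ 1` modulo `p` annihilating it. By Cauchy's theorem its order is prime
to `p`. -/
theorem exists_not_dvd_indexOf {p : ℕ} [hp : Fact p.Prime]
    (h : coveringNumber (𝓞 K ⧸ Ideal.span {(p : 𝓞 K)}) = ⊤) :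
    ∃ θ : 𝓞 K, IntermediateField.adjoin ℚ {(θ : K)} = ⊤ ∧ ¬ p ∣ indexOf θ := by
  obtain ⟨θ, hθ⟩ := coveringNumber_eq_top_iff.1 h
  obtain ⟨θ, rfl⟩ := Ideal.Quotient.mk_surjective θ
  have hgen (x : 𝓞 K) : ∃ m ∈ Algebra.adjoin ℤ {θ}, m - x ∈ Ideal.span {(p : 𝓞 K)} := by
    have hle : NonUnitalSubring.closure {Ideal.Quotient.mk (Ideal.span {(p : 𝓞 K)}) θ} ≤
        (NonUnitalSubring.closure {θ}).map (Ideal.Quotient.mk (Ideal.span {(p : 𝓞 K)})) :=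
      NonUnitalSubring.closure_le.2 (Set.singleton_subset_iff.2 (NonUnitalSubring.mem_map.2
        ⟨θ, NonUnitalSubring.subset_closure (Set.mem_singleton _), rfl⟩))
    rw [hθ, top_le_iff] at hle
    obtain ⟨m, hm, hmx⟩ := map_mk_eq_top_iff.1 hle x
    refine ⟨m, ?_, hmx⟩
    have : NonUnitalSubring.closure {θ} ≤ (Algebra.adjoin ℤ {θ}).toSubring.toNonUnitalSubring :=
      NonUnitalSubring.closure_le.2 (Set.singleton_subset_iff.2
        (Algebra.self_mem_adjoin_singleton ℤ θ))
    exact this hm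
  let N := Subalgebra.toSubmodule (Algebra.adjoin ℤ {θ})
  obtain ⟨r, hr1, hr⟩ := Submodule.exists_sub_one_mem_and_smul_eq_zero_of_fg_of_le_smul
    (Ideal.span {(p : ℤ)}) (⊤ : Submodule ℤ (𝓞 K ⧸ N)) Module.Finite.fg_top (by
      intro x _
      obtain ⟨x, rfl⟩ := Submodule.Quotient.mk_surjective _ x
      obtain ⟨m, hm, hmx⟩ := hgen x
      obtain ⟨c, hc⟩ := Ideal.mem_span_singleton'.1 hmx
      have : x = m + (p : ℤ) • (-c) := by
        rw [zsmul_eq_mul]; push_cast; linear_combination hc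
      rw [this, Submodule.Quotient.mk_add, (Submodule.Quotient.mk_eq_zero N).2 hm, zero_add,
        Submodule.Quotient.mk_smul]
      exact Submodule.smul_mem_smul (Ideal.mem_span_singleton_self _) trivial)
  rw [Ideal.mem_span_singleton] at hr1
  have hpr : ¬ (p : ℤ) ∣ r := by
    intro h
    have : (p : ℤ) ∣ 1 := by simpa using dvd_sub h hr1
    exact (Nat.prime_iff_prime_int.1 hp.out).not_isUnit (isUnit_of_dvd_one this)
  have hr0 : r ≠ 0 := by
    rintro rfl
    exact hpr (dvd_zero _)
  have hrmem (x : 𝓞 K) : r • x ∈ Algebra.adjoin ℤ {θ} :=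
    (Submodule.Quotient.mk_eq_zero N).1 (hr (Submodule.Quotient.mk x) trivial)
  refine ⟨θ, adjoin_eq_top_of_smul_mem_adjoin hr0 hrmem, fun hdvd => ?_⟩
  have := finite_of_smul_mem_adjoin hr0 hrmem
  have hdvd : p ∣ Nat.card (𝓞 K ⧸ N) := hdvd
  obtain ⟨x, hx⟩ := exists_prime_addOrderOf_dvd_card' p hdvd
  refine hpr ?_
  rw [← hx, addOrderOf_dvd_iff_zsmul_eq_zero]
  exact hr x trivial

end Index

/-! ### Bad primes, bad degrees and faulty ideals. -/

section BadPrimes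

variable {K : Type*} [Field K] [NumberField K] {p : ℕ} [hp : Fact p.Prime] {f : ℕ}

/-- If `p` does not divide the index of `θ`, the images of `θ` in the residue fields generate them
and are pairwise nonconjugate, which is impossible for `τ` primes. -/
theorem isCommonIndexDivisor_of_tau_le (hf : 1 < f) (h : tau p f ≤ numPrimes K p f) :
    IsCommonIndexDivisor K p := by
  refine ⟨hp.out, fun θ _ => ?_⟩
  by_contra hdvd
  have : Finite (primesOfDegree K p f) := finite_primesOfDegree
  have hfr : Module.finrank (ZMod p) (GaloisField p f) = f := GaloisField.finrank p (by omega)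
  let e (P : primesOfDegree K p f) : 𝓞 K ⧸ P.1 ≃+* GaloisField p f :=
    (exists_ringEquiv_galoisField P.2).some
  let g (P : primesOfDegree K p f) : 𝓞 K →+* GaloisField p f :=
    (e P : _ →+* _).comp (Ideal.Quotient.mk P.1)
  have hg (P) : Function.Surjective (g P) :=
    (e P).surjective.comp Ideal.Quotient.mk_surjective
  have hker (P) (x : 𝓞 K) : g P x = 0 ↔ x ∈ P.1 := by
    rw [← Ideal.Quotient.eq_zero_iff_mem]
    exact (e P).map_eq_zero_iff
  have hfixed (P) (φ : GaloisField p f ≃ₐ[ZMod p] GaloisField p f) (hφ : φ (g P θ) = g P θ) :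
      φ = 1 := by
    have := ringHom_eq_of_not_dvd_indexOf hdvd (g₁ := (φ : _ →+* _).comp (g P)) (g₂ := g P) hφ
    ext a
    obtain ⟨x, rfl⟩ := hg P a
    exact RingHom.congr_fun this x
  rcases exists_fixed_or_conjugate hfr (by rwa [Nat.card_coe_set_eq]) (fun P => g P θ) with
    ⟨P, φ, hφ, h0⟩ | ⟨P, Q, hPQ, φ, hφ⟩
  -- An image 0 is fixed by every automorphism, and a nontrivial one exists since `f > 1`.
  · have h0 : g P θ = 0 := h0 (hfixed P φ hφ)
    have hcard : 1 < Nat.card (GaloisField p f ≃ₐ[ZMod p] GaloisField p f) := by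
      rwa [IsGalois.card_aut_eq_finrank, hfr]
    have : Nontrivial (GaloisField p f ≃ₐ[ZMod p] GaloisField p f) :=
      Finite.one_lt_card_iff_nontrivial.1 hcard
    obtain ⟨ψ, hψ⟩ := exists_ne (1 : GaloisField p f ≃ₐ[ZMod p] GaloisField p f)
    exact hψ (hfixed P ψ (by rw [h0, map_zero]))
  · have heq := ringHom_eq_of_not_dvd_indexOf hdvd (g₁ := g P) (g₂ := (φ : _ →+* _).comp (g Q)) hφ
    refine hPQ (Subtype.ext ?_)
    ext x
    rw [← hker, ← hker, heq]
    exact φ.map_eq_zero_iff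

theorem mem_badPrimes_of_mem_badDegrees (h : f ∈ badDegrees K p) : p ∈ badPrimes K := by
  refine ⟨hp.out, ?_⟩
  obtain ⟨⟨P, hP⟩, hle⟩ := h
  by_cases hf : f = 1
  · subst hf
    exact .inr (by simpa [tau] using hle)
  · exact .inl (isCommonIndexDivisor_of_tau_le
      (by have := pos_of_mem_primesOfDegree hP; omega) hle)

theorem coveringNumber_lt_coverInfty_of_tau_le {ι : Type*} [Finite ι] {P : ι → Ideal (𝓞 K)}
    (hf : f ≠ 0) (hP : ∀ i, P i ∈ primesOfDegree K p f) (hinj : Function.Injective P)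
    (h : tau p f ≤ Nat.card ι) : coveringNumber (𝓞 K) < coverInfty := by
  have hne := coveringNumber_pi_ne_top (F := GaloisField p f) (GaloisField.finrank p hf) h
  refine lt_of_le_of_lt ?_ (coveringNumber_lt_coverInfty hne)
  rw [← coveringNumber_quotient_iInf hP hinj]
  exact coveringNumber_le_of_surjective Ideal.Quotient.mk_surjective

theorem not_isCommonIndexDivisor
    (h : coveringNumber (𝓞 K ⧸ Ideal.span {(p : 𝓞 K)}) = ⊤) : ¬ IsCommonIndexDivisor K p :=
  fun hK => let ⟨θ, hθ, hdvd⟩ := exists_not_dvd_indexOf h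
    hdvd (hK.2 θ hθ)

/-- For a common index divisor the finite ring `A/pA` has no single generator, hence has a cover;
with `p` primes of degree 1 the standard cover applies. -/
theorem coveringNumber_lt_coverInfty_of_mem_badPrimes (h : p ∈ badPrimes K) :
    coveringNumber (𝓞 K) < coverInfty := by
  rcases h.2 with h | h
  · have hne : coveringNumber (𝓞 K ⧸ Ideal.span {(p : 𝓞 K)}) ≠ ⊤ :=
      fun htop => not_isCommonIndexDivisor htop h
    have : Finite (𝓞 K ⧸ Ideal.span {(p : 𝓞 K)}) :=
      Ideal.finiteQuotientOfFreeOfNeBot _ (by simp [hp.out.ne_zero])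
    exact (coveringNumber_le_of_surjective Ideal.Quotient.mk_surjective).trans_lt
      (coveringNumber_lt_coverInfty hne)
  · have : Finite (primesOfDegree K p 1) := finite_primesOfDegree
    exact coveringNumber_lt_coverInfty_of_tau_le one_ne_zero
      (fun P : primesOfDegree K p 1 => P.2) Subtype.val_injective
      (by simpa [tau, numPrimes, Nat.card_coe_set_eq] using h)

theorem coveringNumber_pi_finset {S : Finset (Ideal (𝓞 K))}
    (hS : (S : Set (Ideal (𝓞 K))) ⊆ primesOfDegree K p f) (hcard : S.card = tau p f) :
    coveringNumber (∀ P : {P : Ideal (𝓞 K) // P ∈ S}, 𝓞 K ⧸ P.1) =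
      coveringNumber (Fin (tau p f) → GaloisField p f) := by
  have hnat : Nat.card {P : Ideal (𝓞 K) // P ∈ S} = tau p f := by
    rw [Nat.card_eq_fintype_card, Fintype.card_coe, hcard]
  rw [coveringNumber_pi_quotient (fun P : {P // P ∈ S} => hS P.2), hnat]

theorem exists_isFaulty_coveringNumber_eq (h : f ∈ badDegrees K p) :
    ∃ I : Ideal (𝓞 K), IsFaulty I ∧
      coveringNumber (𝓞 K ⧸ I) = coveringNumber (Fin (tau p f) → GaloisField p f) := by
  obtain ⟨⟨P, hP⟩, hle⟩ := h
  obtain ⟨T, hT, hcard⟩ := Set.exists_subset_card_eq hle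
  have hTfin : T.Finite := finite_primesOfDegree.subset hT
  have : Finite T := hTfin
  refine ⟨⨅ P : T, P.1, ⟨fun hbot => ?_, p, f, hp.out, pos_of_mem_primesOfDegree hP, ?_⟩, ?_⟩
  · have : (p : 𝓞 K) ∈ ⨅ P : T, P.1 :=
      Ideal.mem_iInf.2 fun P => natCast_mem_of_mem_primesOfDegree (hT P.2)
    rw [hbot, Ideal.mem_bot, Nat.cast_eq_zero] at this
    exact hp.out.ne_zero this
  · rw [← hcard]
    exact Set.ncard_le_ncard (fun P hPT => ⟨hT hPT, Ideal.dvd_iff_le.2 (iInf_le _ (⟨P, hPT⟩ : T))⟩)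
      (finite_primesOfDegree.subset (Set.sep_subset _ _))
  · rw [coveringNumber_quotient_iInf (fun P : T => hT P.2) Subtype.val_injective,
      Nat.card_coe_set_eq, hcard]

end BadPrimes

/-! ### Assembly of the theorem. -/

section NumberFields

variable (K : Type*) [Field K] [NumberField K]

/-- A common index divisor divides one fixed nonzero index; the other bad primes are at most the
degree of `K`, as `∑ e f` equals that degree. -/
theorem finite_badPrimes : (badPrimes K).Finite := by
  obtain ⟨θ, hθ, hne⟩ := exists_adjoin_eq_top_indexOf_ne_zero K
  refine ((indexOf θ).primeFactors.finite_toSet.union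
    (Set.finite_Iic (Module.finrank ℤ (𝓞 K)))).subset ?_
  rintro p ⟨hp, h | h⟩
  · exact .inl (Nat.mem_primeFactors.2 ⟨hp, h.2 θ hθ, hne⟩)
  · have : Fact p.Prime := ⟨hp⟩
    exact .inr (h.trans numPrimes_le_finrank)

/-- A finite covering number is attained on a product of `τ_p(f)` fields with `p ^ f` elements. -/
theorem exists_coveringNumber_pi_galoisField_le (h : coveringNumber (𝓞 K) < coverInfty) :
    ∃ p : ℕ, ∃ _ : Fact p.Prime, p ∈ badPrimes K ∧ ∃ f ∈ badDegrees K p,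
      coveringNumber (𝓞 K ⧸ Ideal.span {(p : 𝓞 K)}) ≤ coveringNumber (𝓞 K) ∧
      coveringNumber (Fin (tau p f) → GaloisField p f) ≤ coveringNumber (𝓞 K) := by
  obtain ⟨p, hp, hle⟩ := exists_prime_coveringNumber_quotient_le h
  have hp' : Fact p.Prime := ⟨hp⟩
  obtain ⟨f, hf, hfle⟩ := exists_mem_badDegrees_coveringNumber_le
    (ne_top_of_le_ne_top (lt_coverInfty_iff.1 h).1 hle)
  exact ⟨p, hp', mem_badPrimes_of_mem_badDegrees hf, f, hf, hle, hfle.trans hle⟩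

theorem coveringNumber_le_quotient (I : Ideal (𝓞 K)) :
    coveringNumber (𝓞 K) ≤ coveringNumber (𝓞 K ⧸ I) :=
  coveringNumber_le_of_surjective Ideal.Quotient.mk_surjective

variable {K}

theorem coveringNumber_lt_coverInfty_of_isFaulty {I : Ideal (𝓞 K)} (hI : IsFaulty I) :
    coveringNumber (𝓞 K) < coverInfty := by
  obtain ⟨-, p, f, hp, hf, hle⟩ := hI
  have : Fact p.Prime := ⟨hp⟩
  have : Finite {P ∈ primesOfDegree K p f | P ∣ I} :=
    finite_primesOfDegree.subset (Set.sep_subset _ _)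
  exact coveringNumber_lt_coverInfty_of_tau_le hf.ne'
    (fun P : {P ∈ primesOfDegree K p f | P ∣ I} => P.2.1) Subtype.val_injective
    (by rwa [Nat.card_coe_set_eq])

end NumberFields

theorem theorem29 (K : Type*) [Field K] [NumberField K] :
    (badPrimes K).Finite ∧
    (coveringNumber (𝓞 K) ≠ coverInfty →
      coveringNumber (𝓞 K) =
        ⨅ I ∈ {I : Ideal (𝓞 K) | IsFaulty I}, coveringNumber (𝓞 K ⧸ I) ∧
      (∀ S : ℕ → ℕ → Finset (Ideal (𝓞 K)),
        (∀ p ∈ badPrimes K, ∀ f ∈ badDegrees K p,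
          (S p f : Set (Ideal (𝓞 K))) ⊆ primesOfDegree K p f ∧ (S p f).card = tau p f) →
        coveringNumber (𝓞 K) =
          ⨅ p ∈ badPrimes K, ⨅ f ∈ badDegrees K p,
            coveringNumber (∀ P : {P : Ideal (𝓞 K) // P ∈ S p f}, 𝓞 K ⧸ P.1)) ∧
      coveringNumber (𝓞 K) =
        ⨅ p ∈ badPrimes K, coveringNumber (𝓞 K ⧸ Ideal.span {(p : 𝓞 K)})) ∧
    (coveringNumber (𝓞 K) = coverInfty →
      (∀ I : Ideal (𝓞 K), ¬ IsFaulty I) ∧ badPrimes K = ∅) := by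
  refine ⟨finite_badPrimes K, fun hσ => ?_, fun hσ => ⟨fun I hI => ?_, ?_⟩⟩
  · have hlt : coveringNumber (𝓞 K) ≠ ⊤ → coveringNumber (𝓞 K) < coverInfty :=
      fun h => lt_coverInfty_iff.2 ⟨h, hσ⟩
    refine ⟨le_antisymm (le_iInf₂ fun I _ => coveringNumber_le_quotient K I) ?_, fun S hS =>
      le_antisymm (le_iInf₂ fun p hp => le_iInf₂ fun f hf => ?_) ?_,
      le_antisymm (le_iInf₂ fun p _ => coveringNumber_le_quotient K _) ?_⟩
    · by_cases htop : coveringNumber (𝓞 K) = ⊤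
      · exact htop ▸ le_top
      obtain ⟨p, hp, -, f, hf, -, hle⟩ := exists_coveringNumber_pi_galoisField_le K (hlt htop)
      obtain ⟨I, hI, hIσ⟩ := exists_isFaulty_coveringNumber_eq hf
      exact (iInf₂_le I hI).trans (hIσ.trans_le hle)
    · have : Fact p.Prime := ⟨hp.1⟩
      obtain ⟨I, -, hI⟩ := exists_isFaulty_coveringNumber_eq hf
      obtain ⟨hsub, hcard⟩ := hS p hp f hf
      rw [coveringNumber_pi_finset hsub hcard, ← hI]
      exact coveringNumber_le_quotient K I
    · by_cases htop : coveringNumber (𝓞 K) = ⊤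
      · exact htop ▸ le_top
      obtain ⟨p, hp, hpbad, f, hf, -, hle⟩ := exists_coveringNumber_pi_galoisField_le K (hlt htop)
      obtain ⟨hsub, hcard⟩ := hS p hpbad f hf
      rw [← coveringNumber_pi_finset hsub hcard] at hle
      exact ((iInf₂_le p hpbad).trans (iInf₂_le f hf)).trans hle
    · by_cases htop : coveringNumber (𝓞 K) = ⊤
      · exact htop ▸ le_top
      obtain ⟨p, hp, hpbad, f, hf, hle, -⟩ := exists_coveringNumber_pi_galoisField_le K (hlt htop)
      exact (iInf₂_le p hpbad).trans hle
  · exact (coveringNumber_lt_coverInfty_of_isFaulty hI).ne hσ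
  · refine Set.eq_empty_of_forall_notMem fun p hp => ?_
    have : Fact p.Prime := ⟨hp.1⟩
    exact (coveringNumber_lt_coverInfty_of_mem_badPrimes hp).ne hσ
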